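/- Let $M,N\ge 1$ be integers with $M\neq N$, let $q\in\mathbb C$ with $0<|q|<1$, fix a logarithm $\log q$ and put $q^x=e^{x\log q}$ for $x\in\mathbb C$ and $[n]_q=\frac{q^n-q^{-n}}{q-q^{-1}}$. **Bosons.** Let $a_m^i,Q_a^i$ $(1\le i\le M)$, $b_m^j,Q_b^j$, $c_m^j,Q_c^j$ $(1\le j\le N)$, $m\in\mathbb Z$, satisfy $[a_m^i,a_n^j]=\delta_{i,j}\delta_{m+n,0}\frac{[m]_q^2}{m}$ for $m\neq0$, $[a_0^i,Q_a^j]=\delta_{i,j}$, the same for $c$, the same with the opposite sign for $b$, all other commutators being $0$. They act on the direct sum $\mathcal F$, over all charges $\lambda=(\lambda_a,\lambda_b,\lambda_c)\in\mathbb C^{M+2N}$, of the Fock spaces $\mathcal F_\lambda$ generated by the modes with $m<0$ over $e^{\sum\lambda_a^iQ_a^i+\sum\lambda_b^jQ_b^j+\sum\lambda_c^jQ_c^j}|0\rangle$, where the modes with $m\geq 0$ annihilate $|0\rangle$. In a normal ordered product $:\ :$ modes with $m<0$ stand to the left of modes with $m>0$, and the $Q$'s to the left of the zero modes. Put $$h_m^i=\begin{cases}a_m^iq^{-|m|/2}-a_m^{i+1}q^{|m|/2}&(1\le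 i\le M-1)\\ a_m^Mq^{-|m|/2}+b_m^1q^{-|m|/2}&(i=M)\\ -b_m^{i-M}q^{|m|/2}+b_m^{i+1-M}q^{-|m|/2}&(M+1\le i\le M+N-1)\end{cases}$$ and let $Q_h^i$ be $Q_a^i-Q_a^{i+1}$, $Q_a^M+Q_b^1$, $-Q_b^{i-M}+Q_b^{i+1-M}$ in the three cases. For a boson $w$ let $w(z;\alpha)=-\sum_{m\ne0}\frac{w_m}{[m]_q}q^{-\alpha|m|}z^{-m}+Q_w+w_0\log z$, where $\log (q^{t}z)=t\log q+\log z$, and let ${}_1\partial_zf(z)=\frac{f(qz)-f(q^{-1}z)}{(q-q^{-1})z}$. The level-one Drinfeld generators of $U_q(\widehat{sl}(M|N))$ are realized by $c=1$, $H_m^i=h_m^i$ and the currents $X^{\pm,i}(z)=\sum_mX^{\pm,i}_mz^{-m-1}$ given by \begin{align*} X^{+,i}(z)&=\,:e^{h^i(z;\frac12)}e^{\pi\sqrt{-1}a_0^i}:, & X^{-,i}(z)&=-:e^{-h^i(z;-\frac12)}e^{-\pi\sqrt{-1}a_0^i}: & (1\le i\le M-1),\\ X^{+,M}(z)&=\,:e^{h^M(z;\frac12)+c^1(z;0)}\textstyle\prod_{j<M}e^{-\pi\sqrt{-1}a_0^j}:,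 & X^{-,M}(z)&=\,:e^{-h^M(z;-\frac12)}({}_1\partial_ze^{-c^1(z;0)})\textstyle\prod_{j<M}e^{\pi\sqrt{-1}a_0^j}:,\\ X^{+,M+j}(z)&=\,:e^{h^{M+j}(z;\frac12)}({}_1\partial_ze^{-c^j(z;0)})e^{c^{j+1}(z;0)}:, & X^{-,M+j}(z)&=-:e^{-h^{M+j}(z;-\frac12)+c^j(z;0)}({}_1\partial_ze^{-c^{j+1}(z;0)}): & (1\le j\le N-1). \end{align*} On $\mathcal F$ these are formal series in complex powers of $z$, and $X_m^{\pm,i}$ denotes the coefficient of $z^{-m-1}$. **The operator $d$.** Let $\alpha_{i,j}=\min(i,j)$ if $\min(i,j)\le M$ and $2M-\min(i,j)$ otherwise; let $\beta_{i,j}=M-N-\max(i,j)$ if $\max(i,j)\le M$ and $-M-N+\max(i,j)$ otherwise; let $$h_m^{*i}=\sum_{j=1}^{M+N-1}\frac{[\alpha_{i,j}m]_q[\beta_{i,j}m]_q}{[(M-N)m]_q[m]_q}h_m^j\ (m\ne0),\qquad h_0^{*i}=\sum_{j=1}^{M+N-1}\frac{\alpha_{i,j}\beta_{i,j}}{M-N}h_0^j,$$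 $$d=-\frac12\sum_{m\ne0}\frac{m^2}{[m]_q^2}\Big(\sum_{i=1}^{M+N-1}:h_{-m}^ih_m^{*i}:+\sum_{i=1}^N:c_{-m}^ic_m^i:\Big)-\frac12\Big(\sum_{i=1}^{M+N-1}h_0^ih_0^{*i}+\sum_{i=1}^Nc_0^i(c_0^i+1)\Big).$$ **Proposition.** The infinite sums defining $d$ and the coefficients of the normally ordered exponentials are locally finite on $\mathcal F$, and $d$ satisfies the defining relations of the grading operator of $U_q(\widehat{sl}(M|N))$ at level one in the Drinfeld realization. That is, for $1\le i\le M+N-1$ and $m\in\mathbb Z$, $$[d,H_m^i]=mH_m^i\ \text{(in particular } [d,H_0^i]=0),\qquad [d,X_m^{\pm,i}]=mX_m^{\pm,i},$$ and there is an invertible operator $q^d=\exp(d\log q)$ on $\mathcal F$ (the exponential series converging weakly on each vector, i.e. after applying any linear functional), with inverse $q^{-d}=\exp(-d\log q)$, such that $$q^dX^{\pm,i}(z)q^{-d}=q^{-1}X^{\pm,i}(q^{-1}z).$$ Moreover $$q^de^{\pm Q_c^j}q^{-d}=e^{\pm Q_c^j}q^{\mp c_0^j}q^{-\frac12(1\pm1)}\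 (1\le j\le N),\qquad q^de^{\pm Q_h^i}q^{-d}=e^{\pm Q_h^i}q^{\mp h_0^i}\times\begin{cases}q^{-1}&(1\le i\le M-1)\\1&(i=M)\\q&(M+1\le i\le M+N-1).\end{cases}$$ For a charge $\lambda$ let $\widehat{\mathcal F}_\lambda$ be the direct sum of the Fock spaces of charges $\lambda+(i_1,i_2-i_1,\dots,i_M-i_{M-1};\,\kappa;\,\kappa)$ with $\kappa=(i_M-i_{M+1},\dots,i_{M+N-2}-i_{M+N-1},i_{M+N-1})$, over $i_1,\dots,i_{M+N-1}\in\mathbb Z$. If $\lambda$ is one of (1) $\lambda_{a},\lambda_b=(\overbrace{\beta+1,\dots,\beta+1}^{i},\overbrace{\beta,\dots,\beta}^{M+N-i})$ with $\lambda_c=0$ if $1\le i\le M$ and $\lambda_c=(\overbrace{0,\dots,0}^{i-M},\overbrace{-1,\dots,-1}^{M+N-i})$ if $M+1\le i\le M+N$, (2) $\lambda_a=(\beta,\dots,\beta)$, $\lambda_b=(\beta-\alpha,\dots,\beta-\alpha)$, $\lambda_c=(-\alpha,\dots,-\alpha)$, with $\alpha,\beta\in\mathbb C$, then $\widehat{\mathcal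 F}_\lambda$ is stable under $d$, $q^{\pm d}$, all $H_m^i$ and all $X_m^{\pm,i}$, and only integral powers of $z$ occur in $X^{\pm,i}(z)$ on $\widehat{\mathcal F}_\lambda$. Finally, for $N=1$ and $M\ge2$ the formula becomes $$d=-\frac12\sum_{m\ne0}\frac{m^2}{[m]_q^2}\Big(\sum_{i=1}^{M}:h_{-m}^ih_m^{*i}:+:c_{-m}^1c_m^1:\Big)-\frac12\Big(\sum_{i=1}^{M}h_0^ih_0^{*i}+c_0^1(c_0^1+1)\Big)$$ with $h_m^{*i}=\sum_{j=1}^M\frac{[\min(i,j)m]_q[(M-1-\max(i,j))m]_q}{[(M-1)m]_q[m]_q}h_m^j$ for $m\ne0$ and $h_0^{*i}=\sum_{j=1}^M\frac{\min(i,j)(M-1-\max(i,j))}{M-1}h_0^j$. -/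

import Mathlib

noncomputable section

namespace SuperBoson

/-- Labels of the bosons: `a^1,…,a^M`, then `b^1,…,b^N`, then `c^1,…,c^N`. -/
abbrev Label (M N : ℕ) : Type := Fin M ⊕ Fin N ⊕ Fin N

/-- A charge `(λ_a, λ_b, λ_c)`. Also used for coefficient vectors of linear
combinations of the bosons. -/
abbrev Charge (M N : ℕ) : Type := Label M N → ℂ

/-- Polynomials in the creation operators; the variable `(s, n)` is the mode `-(n+1)` of
the boson `s`. -/
abbrev Poly (M N : ℕ) : Type := MvPolynomial (Label M N × ℕ) ℂ

/-- The direct sum of all the Fock representations, over all complex charges.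
`Finsupp.single μ p` is `p` applied to `e^{∑ μ_s Q_s}|0⟩`. -/
abbrev Fock (M N : ℕ) : Type := Charge M N →₀ Poly M N

/-- Linear operators on the total Fock space. -/
abbrev Op (M N : ℕ) : Type := Module.End ℂ (Fock M N)

/-- `q^x = exp (x log q)`, where `τ = log q` is the chosen logarithm of `q`. -/
def qpow (τ x : ℂ) : ℂ := Complex.exp (τ * x)

/-- The `q`-integer `[n]_q = (q^n - q^{-n}) / (q - q⁻¹)`. -/
def qint (τ : ℂ) (n : ℤ) : ℂ :=
  (qpow τ n - qpow τ (-n)) / (qpow τ 1 - qpow τ (-1))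

/-! ### Locally finite sums of operators, exponential of an operator -/

/-- Every vector is killed by all but finitely many of the operators. -/
def IsLocFinite {κ V W : Type*} [AddCommGroup V] [Module ℂ V] [AddCommGroup W] [Module ℂ W]
    (T : κ → V →ₗ[ℂ] W) : Prop :=
  ∀ v, (Function.support fun k => T k v).Finite

open Classical in
/-- The sum of a locally finite family of operators (`0` if it is not locally finite). -/
def locSum {κ V W : Type*} [AddCommGroup V] [Module ℂ V] [AddCommGroup W] [Module ℂ W]
    (T : κ → V →ₗ[ℂ] W) : V →ₗ[ℂ] W :=
  if h : IsLocFinite T then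
    { toFun := fun v => ∑ᶠ k, T k v
      map_add' := fun v w => by
        simp only [map_add]
        exact finsum_add_distrib (h v) (h w)
      map_smul' := fun r v => by
        simp only [map_smul, RingHom.id_apply]
        exact (smul_finsum' r (h v)).symm }
  else 0

/-- `E = exp D`: the exponential series of `D` converges to `E` on every vector, weakly,
i.e. after every linear functional is applied. There is at most one such `E`. -/
def IsExpOf {V : Type*} [AddCommGroup V] [Module ℂ V] (D E : Module.End ℂ V) : Prop :=
  ∀ (v : V) (f : V →ₗ[ℂ] ℂ),
    HasSum (fun n : ℕ => f (((n.factorial : ℂ)⁻¹) • (D ^ n) v)) (f (E v))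

/-- The coefficient of `w^k` in `exp (∑_{n ≥ 1} U n w^n)`, for commuting `U n`. -/
def expCoeff {A : Type*} [Ring A] [Algebra ℂ A] (U : ℕ → A) (k : ℕ) : A :=
  ∑ j ∈ Finset.range (k + 1), ((j.factorial : ℂ)⁻¹) •
    PowerSeries.coeff k ((PowerSeries.mk fun n => if n = 0 then 0 else U n) ^ j)

/-! ### The bosonic oscillators -/

section Oscillators

variable (M N : ℕ) (τ : ℂ)

/-- The sign of the boson: `+1` for `a` and `c`, `-1` for `b`. -/
def sgn : Label M N → ℂ
  | .inl _ => 1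
  | .inr (.inl _) => -1
  | .inr (.inr _) => 1

/-- The operator that acts on the sector of charge `μ` by `T μ` and then moves it to
charge `μ + v`. -/
def sectorwise (v : Charge M N) (T : Charge M N → Module.End ℂ (Poly M N)) : Op M N :=
  Finsupp.lsum ℂ fun μ => Finsupp.lsingle (μ + v) ∘ₗ T μ

/-- The bosons `a_m^i`, `b_m^j`, `c_m^j`:
`[s_m, s'_n] = ± δ_{s,s'} δ_{m+n,0} [m]_q² / m` and `[s_0, Q_{s'}] = ± δ_{s,s'}`, with the
sign `sgn s`. -/
def boson (s : Label M N) : ℤ → Op M N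
  | .ofNat 0 => sectorwise M N 0 fun μ => (sgn M N s * μ s) • 1
  | .ofNat (n + 1) => sectorwise M N 0 fun _ =>
      (sgn M N s * qint τ (n + 1) ^ 2 / (n + 1)) • (MvPolynomial.pderiv (s, n)).toLinearMap
  | .negSucc n => sectorwise M N 0 fun _ => LinearMap.mulLeft ℂ (MvPolynomial.X (s, n))

/-- The mode `∑_s v_s s_m`. -/
def mode (v : Charge M N) (m : ℤ) : Op M N := ∑ s, v s • boson M N τ s m

/-- The value of `∑_s v_s s_0` on the sector of charge `μ`. -/
def zeroVal (v μ : Charge M N) : ℂ := ∑ s, v s * (sgn M N s * μ s)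

/-- The operator `e^{∑_s v_s Q_s}`. -/
def expQ (v : Charge M N) : Op M N := sectorwise M N v fun _ => 1

/-- The operator `e^{∑_s u_s s_0}`. -/
def expZero (u : Charge M N) : Op M N :=
  sectorwise M N 0 fun μ => Complex.exp (zeroVal M N u μ) • 1

open Classical in
/-- The coefficient of `z^y` in `z^{∑_s v_s s_0}`. -/
def zPowCoeff (v : Charge M N) (y : ℂ) : Op M N :=
  sectorwise M N 0 fun μ => if zeroVal M N v μ = y then 1 else 0

/-- The unit vector of `a^i`, `1 ≤ i ≤ M`. -/
def eA (i : ℕ) : Charge M N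
  | .inl k => if (k : ℕ) + 1 = i then 1 else 0
  | .inr _ => 0

/-- The unit vector of `b^j`, `1 ≤ j ≤ N`. -/
def eB (j : ℕ) : Charge M N
  | .inl _ => 0
  | .inr (.inl k) => if (k : ℕ) + 1 = j then 1 else 0
  | .inr (.inr _) => 0

/-- The unit vector of `c^j`, `1 ≤ j ≤ N`. -/
def eC (j : ℕ) : Charge M N
  | .inl _ => 0
  | .inr (.inl _) => 0
  | .inr (.inr k) => if (k : ℕ) + 1 = j then 1 else 0

/-- The coefficients of `h_m^i`, `1 ≤ i ≤ M + N - 1`. At `m = 0` these are also the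
coefficients of `Q_h^i`. -/
def hVec (i : ℕ) (m : ℤ) : Charge M N :=
  if i < M then
    qpow τ (-(|m| : ℤ) / 2) • eA M N i - qpow τ ((|m| : ℤ) / 2) • eA M N (i + 1)
  else if i = M then
    qpow τ (-(|m| : ℤ) / 2) • eA M N M + qpow τ (-(|m| : ℤ) / 2) • eB M N 1
  else
    -(qpow τ ((|m| : ℤ) / 2) • eB M N (i - M)) + qpow τ (-(|m| : ℤ) / 2) • eB M N (i + 1 - M)

/-- `h_m^i`, `1 ≤ i ≤ M + N - 1`; this is the Drinfeld generator `H_m^i` at level one. -/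
def h (i : ℕ) (m : ℤ) : Op M N := mode M N τ (hVec M N τ i m) m

/-- `c_m^j`, `1 ≤ j ≤ N`. -/
def c (j : ℕ) (m : ℤ) : Op M N := mode M N τ (eC M N j) m

/-- `α_{i,j}`. -/
def alpha (i j : ℕ) : ℤ := if min i j ≤ M then (min i j : ℤ) else 2 * M - (min i j : ℤ)

/-- `β_{i,j}`. -/
def beta (i j : ℕ) : ℤ :=
  if max i j ≤ M then (M : ℤ) - N - (max i j : ℤ) else -(M : ℤ) - N + (max i j : ℤ)

/-- `h_m^{*i}`, `1 ≤ i ≤ M + N - 1`. -/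
def hStar (i : ℕ) (m : ℤ) : Op M N :=
  if m = 0 then
    ∑ j ∈ Finset.Icc 1 (M + N - 1),
      ((alpha M i j : ℂ) * (beta M N i j : ℂ) / ((M : ℂ) - N)) • h M N τ j 0
  else
    ∑ j ∈ Finset.Icc 1 (M + N - 1),
      (qint τ (alpha M i j * m) * qint τ (beta M N i j * m) /
        (qint τ (((M : ℤ) - N) * m) * qint τ m)) • h M N τ j m

/-! ### The grading operator -/

/-- The normally ordered product `:A_m B_n:` of modes with `m ≠ 0`. -/
def normOrd (A B : ℤ → Op M N) (m n : ℤ) : Op M N :=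
  if m < 0 then A m * B n else B n * A m

/-- The term of index `m ≠ 0` of the infinite sum in the grading operator. -/
def gradingTerm (m : {m : ℤ // m ≠ 0}) : Op M N :=
  ((m.1 : ℂ) ^ 2 / qint τ m.1 ^ 2) •
    (∑ i ∈ Finset.Icc 1 (M + N - 1), normOrd M N (h M N τ i) (hStar M N τ i) (-m.1) m.1 +
      ∑ i ∈ Finset.Icc 1 N, normOrd M N (c M N τ i) (c M N τ i) (-m.1) m.1)

/-- The bosonized grading operator `d`. -/
def gradingOp : Op M N :=
  (-(1 / 2) : ℂ) • locSum (gradingTerm M N τ)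
    - (1 / 2 : ℂ) • (∑ i ∈ Finset.Icc 1 (M + N - 1), h M N τ i 0 * hStar M N τ i 0 +
        ∑ i ∈ Finset.Icc 1 N, c M N τ i 0 * (c M N τ i 0 + 1))

/-! ### Boson fields and their normally ordered exponentials -/

/-- The linear field
`∑_{m ≠ 0} ∑_s osc m s · s_m z^{-m} + ∑_s chg s · (Q_s + s_0 log z) + ∑_s cst s · s_0`.
The value `osc 0` is not used. -/
structure LinField (M N : ℕ) where
  osc : ℤ → Charge M N
  chg : Charge M N
  cst : Charge M N

instance : Add (LinField M N) := ⟨fun A B => ⟨A.osc + B.osc, A.chg + B.chg, A.cst + B.cst⟩⟩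

instance : Neg (LinField M N) := ⟨fun A => ⟨-A.osc, -A.chg, -A.cst⟩⟩

/-- The field `-∑_{m ≠ 0} w_m / [m]_q q^{-α|m|} z^{-m} + Q_w + w_0 log z` of a boson `w`
with modes `w_m = ∑_s w m s · s_m`, and `Q_w = ∑_s w 0 s · Q_s`. -/
def bosonField (w : ℤ → Charge M N) (α : ℂ) : LinField M N where
  osc := fun m => (-(qpow τ (-α * (|m| : ℤ)) / qint τ m)) • w m
  chg := w 0
  cst := 0

/-- The field `h^i(z; α)`. -/
def hField (i : ℕ) (α : ℂ) : LinField M N := bosonField M N τ (hVec M N τ i) α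

/-- The field `c^j(z; α)`. -/
def cField (j : ℕ) (α : ℂ) : LinField M N := bosonField M N τ (fun _ => eC M N j) α

/-- The constant field `∑_s u_s s_0`. -/
def constField (u : Charge M N) : LinField M N := ⟨0, 0, u⟩

/-- The field `Φ(q^t z)`, with `log (q^t z) = t log q + log z`. -/
def LinField.rescale {M N : ℕ} (τ : ℂ) (Φ : LinField M N) (t : ℂ) : LinField M N where
  osc := fun m => qpow τ (-t * m) • Φ.osc m
  chg := Φ.chg
  cst := Φ.cst + (t * τ) • Φ.chg

/-- The coefficient of `z^k` in `exp (∑_{n ≥ 1} Φ_{-n} z^n)`. -/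
def creationCoeff (Φ : LinField M N) (k : ℕ) : Op M N :=
  expCoeff (fun n => mode M N τ (Φ.osc (-(n : ℤ))) (-(n : ℤ))) k

/-- The coefficient of `z^{-k}` in `exp (∑_{n ≥ 1} Φ_n z^{-n})`. -/
def annihilationCoeff (Φ : LinField M N) (k : ℕ) : Op M N :=
  expCoeff (fun n => mode M N τ (Φ.osc n) n) k

/-- The contribution of creation degree `k.1` and annihilation degree `k.2` to the
coefficient of `z^x` in `:e^{Φ(z)}:`. -/
def vertexTerm (Φ : LinField M N) (x : ℂ) (k : ℕ × ℕ) : Op M N :=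
  creationCoeff M N τ Φ k.1 * annihilationCoeff M N τ Φ k.2 *
    (expQ M N Φ.chg * zPowCoeff M N Φ.chg (x - k.1 + k.2) * expZero M N Φ.cst)

/-- The normally ordered exponential `:e^{Φ(z)}:` as a formal series in complex powers of
`z`: its value at `x` is the coefficient of `z^x`. -/
def vertex (Φ : LinField M N) (x : ℂ) : Op M N := locSum (vertexTerm M N τ Φ x)

/-- The series `:e^{A(z)} (₁∂_z e^{B(z)}):`, where
`₁∂_z f(z) = (f(q z) - f(q⁻¹ z)) / ((q - q⁻¹) z)`. -/
def vertexDiff (A B : LinField M N) (x : ℂ) : Op M N :=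
  (qpow τ 1 - qpow τ (-1))⁻¹ •
    (vertex M N τ (A + B.rescale τ 1) (x + 1) - vertex M N τ (A + B.rescale τ (-1)) (x + 1))

/-- The coefficient of `z^x` in the level-one current `X^{+,i}(z)`, `1 ≤ i ≤ M + N - 1`. -/
def XPlus (i : ℕ) (x : ℂ) : Op M N :=
  if i < M then
    vertex M N τ (hField M N τ i (1 / 2) +
      constField M N ((Complex.I * Real.pi) • eA M N i)) x
  else if i = M then
    vertex M N τ (hField M N τ M (1 / 2) + cField M N τ 1 0 +
      constField M N (-(Complex.I * Real.pi) • ∑ j ∈ Finset.Icc 1 (M - 1), eA M N j)) x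
  else
    vertexDiff M N τ (hField M N τ i (1 / 2) + cField M N τ (i - M + 1) 0)
      (-cField M N τ (i - M) 0) x

/-- The coefficient of `z^x` in the level-one current `X^{-,i}(z)`, `1 ≤ i ≤ M + N - 1`. -/
def XMinus (i : ℕ) (x : ℂ) : Op M N :=
  if i < M then
    -vertex M N τ (-hField M N τ i (-1 / 2) +
      constField M N (-(Complex.I * Real.pi) • eA M N i)) x
  else if i = M then
    vertexDiff M N τ (-hField M N τ M (-1 / 2) +
      constField M N ((Complex.I * Real.pi) • ∑ j ∈ Finset.Icc 1 (M - 1), eA M N j))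
      (-cField M N τ 1 0) x
  else
    -vertexDiff M N τ (-hField M N τ i (-1 / 2) + cField M N τ (i - M) 0)
      (-cField M N τ (i - M + 1) 0) x

/-! ### The spaces `F_λ` -/

/-- The charge of the highest weight vector for `Λ_i`, with the free parameter `β`. -/
def chargeFund (i : ℕ) (β : ℂ) : Charge M N
  | .inl k => if (k : ℕ) + 1 ≤ i then β + 1 else β
  | .inr (.inl l) => if M + ((l : ℕ) + 1) ≤ i then β + 1 else β
  | .inr (.inr l) => if i ≤ M then 0 else if M + ((l : ℕ) + 1) ≤ i then 0 else -1

/-- The charge of the highest weight vector for `(1 - α) Λ_0 + α Λ_M`, with the free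
parameter `β`. -/
def chargeMixed (α β : ℂ) : Charge M N
  | .inl _ => β
  | .inr (.inl _) => β - α
  | .inr (.inr _) => -α

/-- The charges of the highest weight vectors. -/
def highestCharges : Set (Charge M N) :=
  {μ | (∃ i β, 1 ≤ i ∧ i ≤ M + N ∧ μ = chargeFund M N i β) ∨ ∃ α β, μ = chargeMixed M N α β}

/-- `μ ∘ (i_1, …, i_{M+N-1})`, for `n = (0, i_1, …, i_{M+N-1}, 0)`. -/
def circ (μ : Charge M N) (n : ℕ → ℤ) : Charge M N
  | .inl k => μ (.inl k) + ((n ((k : ℕ) + 1) - n k : ℤ) : ℂ)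
  | .inr (.inl l) => μ (.inr (.inl l)) + ((n (M + l) - n (M + l + 1) : ℤ) : ℂ)
  | .inr (.inr l) => μ (.inr (.inr l)) + ((n (M + l) - n (M + l + 1) : ℤ) : ℂ)

/-- The sum of the Fock representations of charge `μ ∘ (i_1, …, i_{M+N-1})`, over all
integers `i_1, …, i_{M+N-1}`. -/
def fockModule (μ : Charge M N) : Submodule ℂ (Fock M N) :=
  Finsupp.supported (Poly M N) ℂ
    {ρ | ∃ n : ℕ → ℤ, n 0 = 0 ∧ n (M + N) = 0 ∧ ρ = circ M N μ n}

/-- The operator maps the submodule into itself. -/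
def Preserves (T : Op M N) (W : Submodule ℂ (Fock M N)) : Prop := ∀ v ∈ W, T v ∈ W

end Oscillators

/-! ### The formula for `N = 1` -/

section One

variable (M : ℕ) (τ : ℂ)

/-- The dual bosons of `U_q(sl(M|1)^)`, `1 ≤ i ≤ M`. -/
def hStarOne (i : ℕ) (m : ℤ) : Op M 1 :=
  if m = 0 then
    ∑ j ∈ Finset.Icc 1 M,
      (((min i j : ℕ) : ℂ) * ((M : ℂ) - 1 - (max i j : ℕ)) / ((M : ℂ) - 1)) • h M 1 τ j 0
  else
    ∑ j ∈ Finset.Icc 1 M,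
      (qint τ ((min i j : ℤ) * m) * qint τ (((M : ℤ) - 1 - max i j) * m) /
        (qint τ (((M : ℤ) - 1) * m) * qint τ m)) • h M 1 τ j m

/-- The grading operator of `U_q(sl(M|1)^)` at level one. -/
def gradingOpOne : Op M 1 :=
  (-(1 / 2) : ℂ) • locSum (fun m : {m : ℤ // m ≠ 0} =>
      ((m.1 : ℂ) ^ 2 / qint τ m.1 ^ 2) •
        (∑ i ∈ Finset.Icc 1 M, normOrd M 1 (h M 1 τ i) (hStarOne M τ i) (-m.1) m.1 +
          normOrd M 1 (c M 1 τ 1) (c M 1 τ 1) (-m.1) m.1))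
    - (1 / 2 : ℂ) • (∑ i ∈ Finset.Icc 1 M, h M 1 τ i 0 * hStarOne M τ i 0 +
        c M 1 τ 1 0 * (c M 1 τ 1 0 + 1))

end One

end SuperBoson

end

/-! Write `B` for the bilinear form `zeroVal` on coefficient vectors of bosons. The proof rests on
the observation that the grading operator acts on the sector of charge `μ` by `ε(μ) + D`, where `D`
is a derivation of the polynomial algebra in the creation modes and `ε` is a quadratic function.

* For each `k = |m|` the sum `∑ h_{-m}^i h_m^{*i} + ∑ c_{-m}^j c_m^j` encodes the `B`-orthogonal
  projection `proj k` of coefficient vectors onto the span of the `h_k^i` and `c_k^j`. This is the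
  statement that the coefficients of `h_m^{*i}` invert the `q`-Cartan matrix of `sl(M|N)`
  (`cartan_mul_dualCoeff`), which follows from the three-term recurrence and the Wronskian identity
  of `n ↦ [nm]_q`, and likewise for `n ↦ n` at `m = 0`. The remaining direction in the span of the
  `a` and `b` bosons is not seen by the grading operator, which is therefore not the full degree
  operator. The terms of index `m` and `-m` coincide because the coefficient matrix is symmetric,
  and the result is `gradingOp_eq`.
* For any self-adjoint `P k`, the operator `gradOp P ε` satisfies `[d, w_m] = m w_m` for modes whose
  coefficient vector is fixed by `P |m|` (`lie_gradOp_mode`). The relation passes to the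
  coefficients of exponentials, and together with
  `ε(μ + v) = ε(μ) - B(v, μ) - Δ(v)` it says that `:e^{Φ(z)}:` is homogeneous of conformal
  weight `Δ(v)`, `v` being the charge of `Φ` (`lie_gradOp_vertex`). The weight is `1` for each
  current `X^{±,i}(z)`, or `0` where a difference operator supplies the missing unit.
  The case `P = id`, the total degree, gives local finiteness: its eigenvalues have one sign, so
  an annihilation part of high degree kills any given vector.
* Since each `proj k` is idempotent, products of linear eigenvectors of `D` span the polynomials
  (`span_polyEigen`). Hence `d` is diagonalizable, `q^d` exists as `flow`, and conjugation by it
  rescales homogeneous operators (`flow_conj_of_lie`).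
* The currents shift charges by the vectors `±rootVec i`, which generate the lattice of charges of
  each `F_λ`. The zero mode of `rootVec i` takes integral values on the highest weight
  charges, hence on all of `F_λ`. -/

noncomputable section

namespace SuperBoson

/-! ### Operators on sectors and the modes of the bosons -/

section Modes

variable {M N : ℕ} {τ : ℂ}

@[simp]
theorem sectorwise_single (v : Charge M N) (T : Charge M N → Module.End ℂ (Poly M N))
    (μ : Charge M N) (p : Poly M N) :
    sectorwise M N v T (Finsupp.single μ p) = Finsupp.single (μ + v) (T μ p) := by
  simp [sectorwise]

theorem op_ext {S T : Op M N}
    (H : ∀ μ p, S (Finsupp.single μ p) = T (Finsupp.single μ p)) : S = T :=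
  Finsupp.lhom_ext H

/-- `zeroVal` as a bilinear form on charges. -/
def form (M N : ℕ) : Charge M N →ₗ[ℂ] Charge M N →ₗ[ℂ] ℂ :=
  LinearMap.mk₂ ℂ (zeroVal M N)
    (fun u v w => by simp [zeroVal, add_mul, Finset.sum_add_distrib])
    (fun r u v => by
      simp only [zeroVal, Finset.mul_sum, smul_eq_mul, Pi.smul_apply, mul_assoc])
    (fun u v w => by simp [zeroVal, mul_add, Finset.sum_add_distrib])
    (fun r u v => by
      simp only [zeroVal, Finset.mul_sum, smul_eq_mul, Pi.smul_apply]
      exact Finset.sum_congr rfl fun s _ => by ring)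

theorem zeroVal_eq_form (u v : Charge M N) : zeroVal M N u v = form M N u v := rfl

theorem form_comm (u v : Charge M N) : form M N u v = form M N v u := by
  simp only [← zeroVal_eq_form, zeroVal]
  exact Finset.sum_congr rfl fun s _ => by ring

/-- The linear polynomial `∑_s v_s x_{s,n}`: the creation mode of index `-(n+1)` of the
boson with coefficient vector `v`, applied to the vacuum. -/
def linPoly (M N n : ℕ) : Charge M N →ₗ[ℂ] Poly M N where
  toFun v := ∑ s, v s • MvPolynomial.X (s, n)
  map_add' u v := by simp [add_smul, Finset.sum_add_distrib]
  map_smul' r v := by simp [Finset.smul_sum, mul_smul]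

theorem linPoly_apply (n : ℕ) (v : Charge M N) :
    linPoly M N n v = ∑ s, v s • (MvPolynomial.X (s, n) : Poly M N) := rfl

theorem linPoly_single (n : ℕ) (s : Label M N) :
    linPoly M N n (Pi.single s 1) = MvPolynomial.X (s, n) := by
  simp [linPoly_apply, Pi.single_apply, ite_smul]

/-- The derivation by which the annihilation mode of index `n+1` of the boson with
coefficient vector `v` acts on polynomials in the creation modes. -/
def annDer (τ : ℂ) (n : ℕ) (v : Charge M N) : Derivation ℂ (Poly M N) (Poly M N) :=
  ∑ s, (v s * (sgn M N s * qint τ (n + 1) ^ 2 / (n + 1))) • MvPolynomial.pderiv (s, n)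

theorem derivation_sum_apply {ι : Type*} (t : Finset ι)
    (D : ι → Derivation ℂ (Poly M N) (Poly M N)) (p : Poly M N) :
    (∑ i ∈ t, D i) p = ∑ i ∈ t, D i p := by
  classical
  induction t using Finset.induction_on with
  | empty => simp
  | insert a t ha ih => simp [Finset.sum_insert ha, ih]

theorem annDer_X (n n' : ℕ) (v : Charge M N) (s : Label M N) :
    annDer τ n v (MvPolynomial.X (s, n')) =
      if n' = n then MvPolynomial.C (qint τ (n + 1) ^ 2 / (n + 1) * form M N v (Pi.single s 1))
      else 0 := by
  classical
  have hf : form M N v (Pi.single s 1) = v s * sgn M N s := by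
    simp [← zeroVal_eq_form, zeroVal, Pi.single_apply]
  rw [hf]
  simp only [annDer, derivation_sum_apply, Derivation.smul_apply, MvPolynomial.pderiv_X,
    Pi.single_apply, Prod.mk.injEq]
  split_ifs with hn
  · subst hn
    simp only [and_true, smul_ite, smul_zero]
    rw [Finset.sum_ite_eq]
    simp only [Finset.mem_univ, if_true]
    rw [← MvPolynomial.C_1, MvPolynomial.smul_eq_C_mul, ← map_mul]
    congr 1
    ring
  · simp [hn]

theorem annDer_linPoly (n n' : ℕ) (u v : Charge M N) :
    annDer τ n u (linPoly M N n' v) =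
      if n' = n then MvPolynomial.C (qint τ (n + 1) ^ 2 / (n + 1) * form M N u v) else 0 := by
  classical
  have hv : v = ∑ s, v s • (Pi.single s 1 : Charge M N) := by
    ext s; simp [Finset.sum_apply, Pi.single_apply]
  rw [linPoly_apply, map_sum]
  simp only [Derivation.map_smul, annDer_X]
  split_ifs with hn
  · conv_rhs => rw [hv]
    simp only [map_sum, map_smul, Finset.mul_sum]
    refine Finset.sum_congr rfl fun s _ => ?_
    rw [MvPolynomial.smul_eq_C_mul, ← map_mul]
    congr 1
    simp only [smul_eq_mul]
    ring
  · simp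

theorem mode_zero_single (v μ : Charge M N) (p : Poly M N) :
    mode M N τ v 0 (Finsupp.single μ p) = Finsupp.single μ (form M N v μ • p) := by
  have : ∀ s, boson M N τ s 0 = sectorwise M N 0 fun μ => (sgn M N s * μ s) • 1 := fun s => rfl
  simp only [mode, this, LinearMap.sum_apply, LinearMap.smul_apply, sectorwise_single, add_zero,
    Finsupp.smul_single, ← zeroVal_eq_form, zeroVal, Finset.sum_smul, Module.End.one_apply,
    smul_smul]
  exact (map_sum (Finsupp.singleAddHom μ) _ _).symm

theorem mode_pos_single (n : ℕ) (v μ : Charge M N) (p : Poly M N) :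
    mode M N τ v ((n : ℤ) + 1) (Finsupp.single μ p) = Finsupp.single μ (annDer τ n v p) := by
  have : ∀ s, boson M N τ s ((n : ℤ) + 1) = sectorwise M N 0 fun _ =>
      (sgn M N s * qint τ (n + 1) ^ 2 / (n + 1)) • (MvPolynomial.pderiv (s, n)).toLinearMap :=
    fun s => rfl
  simp only [mode, this, LinearMap.sum_apply, LinearMap.smul_apply, sectorwise_single, add_zero,
    Finsupp.smul_single, annDer, derivation_sum_apply, Derivation.smul_apply, smul_smul,
    Derivation.coeFn_coe]
  exact (map_sum (Finsupp.singleAddHom μ) _ _).symm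

theorem mode_neg_single (n : ℕ) (v μ : Charge M N) (p : Poly M N) :
    mode M N τ v (-((n : ℤ) + 1)) (Finsupp.single μ p) =
      Finsupp.single μ (linPoly M N n v * p) := by
  have : ∀ s, boson M N τ s (-((n : ℤ) + 1)) = sectorwise M N 0 fun _ =>
      LinearMap.mulLeft ℂ (MvPolynomial.X (s, n)) := by
    intro s
    rw [show -((n : ℤ) + 1) = Int.negSucc n from rfl]
    rfl
  simp only [mode, this, LinearMap.sum_apply, LinearMap.smul_apply, sectorwise_single, add_zero,
    Finsupp.smul_single, linPoly_apply, Finset.sum_mul, LinearMap.mulLeft_apply, smul_mul_assoc]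
  exact (map_sum (Finsupp.singleAddHom μ) _ _).symm

/-- Every nonzero mode index is `n + 1` or `-(n + 1)`. -/
theorem int_ne_zero_cases {m : ℤ} (hm : m ≠ 0) :
    ∃ n : ℕ, m = (n : ℤ) + 1 ∨ m = -((n : ℤ) + 1) := by
  refine ⟨m.natAbs - 1, ?_⟩
  omega

theorem mode_sum {ι : Type*} (t : Finset ι) (a : ι → ℂ) (v : ι → Charge M N) (m : ℤ) :
    mode M N τ (∑ i ∈ t, a i • v i) m = ∑ i ∈ t, a i • mode M N τ (v i) m := by
  simp only [mode, Finset.sum_apply, Pi.smul_apply, Finset.sum_smul, Finset.smul_sum, smul_eq_mul,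
    mul_smul]
  rw [Finset.sum_comm]

end Modes

/-! ### Grading operators of quadratic type -/

section Grading

variable {M N : ℕ} {τ : ℂ}

/-- The derivation with `x_{s,n} ↦ -(n+1) ∑_r (P_{n+1})_{r,s} x_{r,n}`. If `P k` is a projection
for every `k`, it counts (with sign) the degree in the modes of index `-k` in the range
of `P k`. -/
def degDer (P : ℕ → Charge M N →ₗ[ℂ] Charge M N) : Derivation ℂ (Poly M N) (Poly M N) :=
  MvPolynomial.mkDerivation ℂ fun x =>
    (-((x.2 : ℂ) + 1)) • linPoly M N x.2 (P (x.2 + 1) (Pi.single x.1 1))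

theorem degDer_linPoly (P : ℕ → Charge M N →ₗ[ℂ] Charge M N) (n : ℕ) (v : Charge M N) :
    degDer P (linPoly M N n v) = (-((n : ℂ) + 1)) • linPoly M N n (P (n + 1) v) := by
  classical
  have hv : v = ∑ s, v s • (Pi.single s 1 : Charge M N) := by
    ext s; simp [Finset.sum_apply, Pi.single_apply]
  conv_rhs => rw [hv]
  rw [linPoly_apply]
  simp only [map_sum, map_smul, degDer, MvPolynomial.mkDerivation_X, Derivation.map_smul,
    Finset.smul_sum]
  exact Finset.sum_congr rfl fun s _ => smul_comm _ _ _

/-- The operator acting on the sector of charge `μ` by `ε μ + degDer P`. -/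
def gradOp (P : ℕ → Charge M N →ₗ[ℂ] Charge M N) (ε : Charge M N → ℂ) : Op M N :=
  sectorwise M N 0 fun μ => ε μ • 1 + (degDer P).toLinearMap

theorem gradOp_single (P : ℕ → Charge M N →ₗ[ℂ] Charge M N) (ε : Charge M N → ℂ)
    (μ : Charge M N) (p : Poly M N) :
    gradOp P ε (Finsupp.single μ p) = Finsupp.single μ (ε μ • p + degDer P p) := by
  simp [gradOp]

/-- For a projection `P k` that is self-adjoint for the form, the modes of index `±k` with
coefficient vector in its range are homogeneous. -/
theorem lie_gradOp_mode {P : ℕ → Charge M N →ₗ[ℂ] Charge M N} (ε : Charge M N → ℂ)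
    (hP : ∀ k u v, form M N (P k u) v = form M N u (P k v)) {m : ℤ} {v : Charge M N}
    (hv : m ≠ 0 → P m.natAbs v = v) :
    ⁅gradOp P ε, mode M N τ v m⁆ = (m : ℂ) • mode M N τ v m := by
  rw [Ring.lie_def]
  refine op_ext fun μ p => ?_
  rcases eq_or_ne m 0 with rfl | hm
  · simp [mode_zero_single, gradOp_single, smul_comm (form M N v μ) (ε μ)]
  · have hv := hv hm
    obtain ⟨n, rfl | rfl⟩ := int_ne_zero_cases hm
    · have hn : ((n : ℤ) + 1).natAbs = n + 1 := by omega
      rw [hn] at hv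
      simp only [LinearMap.sub_apply, Module.End.mul_apply, mode_pos_single, gradOp_single,
        LinearMap.smul_apply, Finsupp.smul_single, ← Finsupp.single_sub]
      congr 1
      -- The commutator of two derivations is a derivation; compare on the generators.
      have key : ⁅degDer P, annDer τ n v⁆ = ((n : ℂ) + 1) • annDer τ n v := by
        refine MvPolynomial.derivation_ext fun x => ?_
        obtain ⟨s, n'⟩ := x
        rw [Derivation.commutator_apply, Derivation.smul_apply, ← linPoly_single,
          degDer_linPoly, Derivation.map_smul, annDer_linPoly, annDer_linPoly]
        split_ifs with h'
        · subst h'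
          rw [← hP, hv, MvPolynomial.derivation_C, zero_sub, ← neg_smul, neg_neg]
        · simp
      have := congrArg (fun D => D p) key
      simp only [Derivation.commutator_apply, Derivation.smul_apply] at this
      rw [map_add, Derivation.map_smul]
      push_cast
      rw [← this]
      abel
    · have hn : (-((n : ℤ) + 1)).natAbs = n + 1 := by omega
      rw [hn] at hv
      simp only [LinearMap.sub_apply, Module.End.mul_apply, mode_neg_single, gradOp_single,
        LinearMap.smul_apply, Finsupp.smul_single, ← Finsupp.single_sub]
      congr 1
      rw [Derivation.leibniz, degDer_linPoly, hv]
      push_cast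
      simp only [smul_eq_mul, MvPolynomial.smul_eq_C_mul]
      ring

/-! ### Coefficients of exponentials -/

theorem lie_mul_of_lie {A : Type*} [Ring A] [Algebra ℂ A] {D a b : A} {r s : ℂ}
    (ha : ⁅D, a⁆ = r • a) (hb : ⁅D, b⁆ = s • b) : ⁅D, a * b⁆ = (r + s) • (a * b) := by
  rw [Ring.lie_def] at *
  have : D * (a * b) - a * b * D = (D * a - a * D) * b + a * (D * b - b * D) := by
    noncomm_ring
  rw [this, ha, hb, smul_mul_assoc, mul_smul_comm, ← add_smul]

/-- A relation `[D, U n] = n λ U n` passes to the coefficients of `exp (∑ U n w^n)`. -/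
theorem lie_expCoeff {A : Type*} [Ring A] [Algebra ℂ A] (D : A) (U : ℕ → A) (l : ℂ)
    (hU : ∀ n, n ≠ 0 → ⁅D, U n⁆ = ((n : ℂ) * l) • U n) (k : ℕ) :
    ⁅D, expCoeff U k⁆ = ((k : ℂ) * l) • expCoeff U k := by
  set F : PowerSeries A := PowerSeries.mk fun n => if n = 0 then 0 else U n with hF
  have h1 : ∀ n, ⁅D, PowerSeries.coeff n F⁆ = ((n : ℂ) * l) • PowerSeries.coeff n F := by
    intro n
    rw [hF, PowerSeries.coeff_mk]
    split_ifs with h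
    · simp [Ring.lie_def]
    · exact hU n h
  have hj : ∀ j k : ℕ, ⁅D, PowerSeries.coeff k (F ^ j)⁆ =
      ((k : ℂ) * l) • PowerSeries.coeff k (F ^ j) := by
    intro j
    induction j with
    | zero =>
      intro k
      rw [pow_zero, PowerSeries.coeff_one]
      split_ifs with h
      · simp [h, Ring.lie_def]
      · simp [Ring.lie_def]
    | succ j ih =>
      intro k
      rw [pow_succ, PowerSeries.coeff_mul, Ring.lie_def, Finset.mul_sum, Finset.sum_mul,
        ← Finset.sum_sub_distrib, Finset.smul_sum]
      refine Finset.sum_congr rfl fun x hx => ?_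
      rw [Finset.HasAntidiagonal.mem_antidiagonal] at hx
      have e1 := ih x.1
      have e2 := h1 x.2
      rw [← hx, ← Ring.lie_def, lie_mul_of_lie e1 e2]
      push_cast
      congr 1
      ring
  rw [expCoeff, Ring.lie_def, Finset.mul_sum, Finset.sum_mul, ← Finset.sum_sub_distrib,
    Finset.smul_sum]
  refine Finset.sum_congr rfl fun j _ => ?_
  rw [mul_smul_comm, smul_mul_assoc, ← smul_sub, ← Ring.lie_def, hj, smul_comm]

theorem lie_gradOp_creationCoeff {P : ℕ → Charge M N →ₗ[ℂ] Charge M N} (ε : Charge M N → ℂ)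
    (hP : ∀ k u v, form M N (P k u) v = form M N u (P k v)) {Φ : LinField M N}
    (hΦ : ∀ m : ℤ, m ≠ 0 → P m.natAbs (Φ.osc m) = Φ.osc m) (k : ℕ) :
    ⁅gradOp P ε, creationCoeff M N τ Φ k⁆ = (-(k : ℂ)) • creationCoeff M N τ Φ k := by
  have := lie_expCoeff (gradOp P ε)
    (fun n => mode M N τ (Φ.osc (-(n : ℤ))) (-(n : ℤ))) (-1) (fun n hn => by
      rw [lie_gradOp_mode ε hP (hΦ _)]
      push_cast
      rw [mul_neg_one]) k
  rwa [mul_neg_one] at this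

theorem lie_gradOp_annihilationCoeff {P : ℕ → Charge M N →ₗ[ℂ] Charge M N} (ε : Charge M N → ℂ)
    (hP : ∀ k u v, form M N (P k u) v = form M N u (P k v)) {Φ : LinField M N}
    (hΦ : ∀ m : ℤ, m ≠ 0 → P m.natAbs (Φ.osc m) = Φ.osc m) (k : ℕ) :
    ⁅gradOp P ε, annihilationCoeff M N τ Φ k⁆ = (k : ℂ) • annihilationCoeff M N τ Φ k := by
  have := lie_expCoeff (gradOp P ε)
    (fun n => mode M N τ (Φ.osc n) n) 1 (fun n hn => by
      rw [lie_gradOp_mode ε hP (hΦ _)]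
      push_cast
      rw [mul_one]) k
  rwa [mul_one] at this

end Grading

/-! ### Locally finite sums -/

section LocFinite

theorem locSum_apply {κ V W : Type*} [AddCommGroup V] [Module ℂ V] [AddCommGroup W] [Module ℂ W]
    {T : κ → V →ₗ[ℂ] W} (hT : IsLocFinite T) (v : V) : locSum T v = ∑ᶠ k, T k v := by
  rw [locSum, dif_pos hT]
  rfl

theorem lie_locSum {κ V : Type*} [AddCommGroup V] [Module ℂ V] {T : κ → Module.End ℂ V}
    (hT : IsLocFinite T) {D : Module.End ℂ V} {r : ℂ} (hD : ∀ k, ⁅D, T k⁆ = r • T k) :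
    ⁅D, (locSum T : Module.End ℂ V)⁆ = r • (locSum T : Module.End ℂ V) := by
  rw [Ring.lie_def]
  refine LinearMap.ext fun v => ?_
  have h1 : ∀ k, D (T k v) = T k (D v) + r • T k v := fun k => by
    have := LinearMap.congr_fun (hD k) v
    rw [Ring.lie_def] at this
    simp only [LinearMap.sub_apply, Module.End.mul_apply, LinearMap.smul_apply] at this
    rw [← this]
    abel
  have h2 : (Function.support fun k => r • T k v).Finite :=
    (hT v).subset (Function.support_const_smul_subset r _)
  simp only [LinearMap.sub_apply, Module.End.mul_apply, LinearMap.smul_apply, locSum_apply hT]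
  rw [map_finsum D (hT v)]
  simp only [h1]
  rw [finsum_add_distrib (hT _) h2, smul_finsum' r (hT v)]
  abel

theorem isLocFinite_of_monomial {M N : ℕ} {κ : Type*} {T : κ → Op M N}
    (H : ∀ μ d a, (Function.support fun k =>
      T k (Finsupp.single μ (MvPolynomial.monomial d a))).Finite) : IsLocFinite T := by
  have hadd : ∀ v w, (Function.support fun k => T k v).Finite →
      (Function.support fun k => T k w).Finite →
      (Function.support fun k => T k (v + w)).Finite := fun v w hv hw => by
    simp only [map_add]
    exact (hv.union hw).subset (Function.support_add _ _)
  intro v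
  induction v using Finsupp.induction_linear with
  | zero => simp
  | add v w hv hw => exact hadd v w hv hw
  | single μ p =>
    induction p using MvPolynomial.induction_on' with
    | monomial d a => exact H μ d a
    | add p q hp hq =>
      rw [Finsupp.single_add]
      exact hadd _ _ hp hq

end LocFinite

/-! ### Vertex operators -/

section Vertex

variable {M N : ℕ} {τ : ℂ}

theorem zeroPart_single (v u μ : Charge M N) (y : ℂ) (p : Poly M N) :
    (expQ M N v * zPowCoeff M N v y * expZero M N u) (Finsupp.single μ p) =
      Finsupp.single (μ + v)
        (if form M N v μ = y then Complex.exp (form M N u μ) • p else 0) := by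
  classical
  simp only [Module.End.mul_apply, expQ, zPowCoeff, expZero, sectorwise_single, add_zero,
    ← zeroVal_eq_form]
  by_cases h : zeroVal M N v μ = y <;> simp [h]

theorem lie_gradOp_zeroPart (P : ℕ → Charge M N →ₗ[ℂ] Charge M N) {ε : Charge M N → ℂ}
    {v : Charge M N} {w : ℂ} (hε : ∀ μ, ε (μ + v) = ε μ - form M N v μ - w)
    (u : Charge M N) (y : ℂ) :
    ⁅gradOp P ε, expQ M N v * zPowCoeff M N v y * expZero M N u⁆ =
      (-(y + w)) • (expQ M N v * zPowCoeff M N v y * expZero M N u) := by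
  rw [Ring.lie_def]
  refine op_ext fun μ p => ?_
  rw [LinearMap.sub_apply, LinearMap.smul_apply, Module.End.mul_apply (gradOp P ε),
    Module.End.mul_apply _ (gradOp P ε), zeroPart_single, gradOp_single, gradOp_single,
    zeroPart_single, Finsupp.smul_single,
    ← Finsupp.single_sub, hε]
  congr 1
  split_ifs with h
  · rw [h, Derivation.map_smul, smul_add, smul_smul, smul_smul, smul_smul]
    rw [add_sub_add_right_eq_sub, ← sub_smul]
    congr 1
    ring
  · simp

theorem lie_gradOp_vertexTerm {P : ℕ → Charge M N →ₗ[ℂ] Charge M N} {ε : Charge M N → ℂ}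
    (hP : ∀ k u v, form M N (P k u) v = form M N u (P k v)) {Φ : LinField M N}
    (hΦ : ∀ m : ℤ, m ≠ 0 → P m.natAbs (Φ.osc m) = Φ.osc m) {w : ℂ}
    (hε : ∀ μ, ε (μ + Φ.chg) = ε μ - form M N Φ.chg μ - w) (x : ℂ) (k : ℕ × ℕ) :
    ⁅gradOp P ε, vertexTerm M N τ Φ x k⁆ = (-(x + w)) • vertexTerm M N τ Φ x k := by
  rw [vertexTerm, lie_mul_of_lie (lie_mul_of_lie (lie_gradOp_creationCoeff ε hP hΦ k.1)
    (lie_gradOp_annihilationCoeff ε hP hΦ k.2)) (lie_gradOp_zeroPart P hε _ _)]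
  congr 1
  ring

/-- The degree of a monomial in the creation modes, the mode of index `-k` having degree `k`. -/
def monDeg (d : Label M N × ℕ →₀ ℕ) : ℕ := d.sum fun x e => e * (x.2 + 1)

/-- For `P = id`, the derivation `degDer P` is minus the total degree. -/
theorem coeff_degDer_id (d : Label M N × ℕ →₀ ℕ) (p : Poly M N) :
    MvPolynomial.coeff d (degDer (fun _ => LinearMap.id) p) =
      -(monDeg d : ℂ) * MvPolynomial.coeff d p := by
  classical
  induction p using MvPolynomial.induction_on' with
  | add p q hp hq => rw [map_add, MvPolynomial.coeff_add, MvPolynomial.coeff_add, hp, hq, mul_add]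
  | monomial e a =>
    have : degDer (fun _ => LinearMap.id) (MvPolynomial.monomial e a : Poly M N) =
        (-(monDeg e : ℂ)) • MvPolynomial.monomial e a := by
      rw [degDer, MvPolynomial.mkDerivation_monomial, monDeg, Finsupp.sum, Finsupp.sum,
        Nat.cast_sum, ← Finset.sum_neg_distrib, Finset.sum_smul, Finset.smul_sum]
      refine Finset.sum_congr rfl fun x hx => ?_
      have hxe : Finsupp.single x 1 ≤ e := by
        rw [Finsupp.single_le_iff]
        exact Nat.one_le_iff_ne_zero.mpr (Finsupp.mem_support_iff.mp hx)
      rw [LinearMap.id_apply, linPoly_single, smul_eq_mul, mul_smul_comm, MvPolynomial.X,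
        MvPolynomial.monomial_mul, tsub_add_cancel_of_le hxe]
      simp only [MvPolynomial.smul_monomial, smul_eq_mul]
      congr 1
      push_cast
      ring
    rw [this, MvPolynomial.coeff_smul, smul_eq_mul, MvPolynomial.coeff_monomial]
    split_ifs with h
    · rw [h]
    · simp

/-- A vector of total degree less than `k` is killed by the annihilation part of degree `k`,
as the total degree operator has no negative eigenvalue. -/
theorem annihilationCoeff_monomial (Φ : LinField M N) (μ : Charge M N)
    (d : Label M N × ℕ →₀ ℕ) (a : ℂ) {k : ℕ} (hk : monDeg d < k) :
    annihilationCoeff M N τ Φ k (Finsupp.single μ (MvPolynomial.monomial d a)) = 0 := by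
  classical
  set v : Fock M N := Finsupp.single μ (MvPolynomial.monomial d a) with hv
  set G : Op M N := gradOp (fun _ => LinearMap.id) (fun _ => 0) with hG
  have hGs : ∀ ρ p, G (Finsupp.single ρ p) =
      Finsupp.single ρ (degDer (fun _ => LinearMap.id) p) := fun ρ p => by
    rw [hG, gradOp_single, zero_smul, zero_add]
  have hcoeff : ∀ (u : Fock M N) ρ e, MvPolynomial.coeff e ((G u) ρ) =
      -(monDeg e : ℂ) * MvPolynomial.coeff e (u ρ) := by
    intro u ρ e
    induction u using Finsupp.induction_linear with
    | zero => simp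
    | add u w hu hw => simp only [map_add, Finsupp.add_apply, MvPolynomial.coeff_add, hu, hw]; ring
    | single σ p =>
      rw [hGs, Finsupp.single_apply, Finsupp.single_apply]
      split_ifs
      · exact coeff_degDer_id e p
      · simp
  have hGv : G v = (-(monDeg d : ℂ)) • v := by
    ext ρ e
    rw [hcoeff, Finsupp.smul_apply, MvPolynomial.coeff_smul, smul_eq_mul, hv, Finsupp.single_apply]
    split_ifs
    · rw [MvPolynomial.coeff_monomial]
      split_ifs with h
      · rw [h]
      · simp
    · simp
  have hl : ⁅G, annihilationCoeff M N τ Φ k⁆ = (k : ℂ) • annihilationCoeff M N τ Φ k :=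
    lie_gradOp_annihilationCoeff _ (fun _ _ _ => rfl) (fun _ _ => rfl) k
  have h2 := LinearMap.congr_fun hl v
  rw [Ring.lie_def] at h2
  simp only [LinearMap.sub_apply, Module.End.mul_apply, LinearMap.smul_apply, hGv, map_smul] at h2
  set u := annihilationCoeff M N τ Φ k v
  ext ρ e
  have h3 := congrArg (fun w : Fock M N => MvPolynomial.coeff e (w ρ)) h2
  simp only [Finsupp.sub_apply, Finsupp.smul_apply, MvPolynomial.coeff_sub, MvPolynomial.coeff_smul,
    hcoeff, smul_eq_mul] at h3
  have h4 : ((monDeg e : ℂ) + ((k : ℂ) - monDeg d)) * MvPolynomial.coeff e (u ρ) = 0 := by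
    linear_combination -h3
  have h5 : ((monDeg e : ℂ) + ((k : ℂ) - monDeg d)) ≠ 0 := by
    have : ((monDeg e : ℂ) + ((k : ℂ) - monDeg d)) = ((monDeg e + (k - monDeg d) : ℕ) : ℂ) := by
      push_cast [Nat.cast_sub hk.le]
      ring
    rw [this]
    exact_mod_cast (by omega : monDeg e + (k - monDeg d) ≠ 0)
  simpa using (mul_eq_zero.mp h4).resolve_left h5

theorem isLocFinite_vertexTerm (Φ : LinField M N) (x : ℂ) :
    IsLocFinite (vertexTerm M N τ Φ x) := by
  classical
  refine isLocFinite_of_monomial fun μ d a => ?_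
  -- The annihilation degree is at most that of the vector, and it determines the creation degree.
  have hfin : {k : ℕ × ℕ | k.2 ≤ monDeg d ∧ form M N Φ.chg μ = x - k.1 + k.2}.Finite := by
    refine Set.Finite.of_finite_image (f := Prod.snd)
      ((Set.finite_Iic (monDeg d)).subset ?_) ?_
    · rintro _ ⟨k, hk, rfl⟩
      exact hk.1
    · rintro ⟨k, l⟩ hk ⟨k', l'⟩ hk' (rfl : l = l')
      have h1 : (k : ℂ) = k' := by
        have e1 := hk.2
        have e2 := hk'.2
        dsimp only at e1 e2
        linear_combination e1 - e2
      rw [Nat.cast_injective h1]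
  refine hfin.subset fun k hk => ?_
  rw [Function.mem_support, vertexTerm, Module.End.mul_apply, zeroPart_single] at hk
  split_ifs at hk with h
  · refine ⟨?_, h⟩
    by_contra hlt
    rw [Module.End.mul_apply, MvPolynomial.smul_monomial,
      annihilationCoeff_monomial _ _ _ _ (not_le.mp hlt), map_zero] at hk
    exact hk rfl
  · simp at hk

/-- The vertex operator of a field whose oscillators are homogeneous is a conformal field of
weight `w`. -/
theorem lie_gradOp_vertex {P : ℕ → Charge M N →ₗ[ℂ] Charge M N} {ε : Charge M N → ℂ}
    (hP : ∀ k u v, form M N (P k u) v = form M N u (P k v)) {Φ : LinField M N}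
    (hΦ : ∀ m : ℤ, m ≠ 0 → P m.natAbs (Φ.osc m) = Φ.osc m) {w : ℂ}
    (hε : ∀ μ, ε (μ + Φ.chg) = ε μ - form M N Φ.chg μ - w) (x : ℂ) :
    ⁅gradOp P ε, vertex M N τ Φ x⁆ = (-(x + w)) • vertex M N τ Φ x :=
  lie_locSum (isLocFinite_vertexTerm Φ x) fun k => lie_gradOp_vertexTerm hP hΦ hε x k

/-! ### Charges -/

/-- The operator that multiplies the sector of charge `μ` by `ε μ`. -/
def chargeOp (ε : Charge M N → ℂ) : Op M N := sectorwise M N 0 fun μ => ε μ • 1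

theorem chargeOp_single (ε : Charge M N → ℂ) (μ : Charge M N) (p : Poly M N) :
    chargeOp ε (Finsupp.single μ p) = Finsupp.single μ (ε μ • p) := by
  simp [chargeOp]

theorem lie_chargeOp_mode (ε : Charge M N → ℂ) (v : Charge M N) (m : ℤ) :
    ⁅chargeOp ε, mode M N τ v m⁆ = 0 := by
  rw [Ring.lie_def]
  refine op_ext fun μ p => ?_
  rcases eq_or_ne m 0 with rfl | hm
  · simp [mode_zero_single, chargeOp_single, smul_comm (form M N v μ) (ε μ)]
  · obtain ⟨n, rfl | rfl⟩ := int_ne_zero_cases hm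
    · simp [mode_pos_single, chargeOp_single]
    · simp only [LinearMap.sub_apply, Module.End.mul_apply, mode_neg_single, chargeOp_single,
        mul_smul_comm, sub_self, LinearMap.zero_apply]

open Classical in
theorem mem_supported_iff_chargeOp (S : Set (Charge M N)) (v : Fock M N) :
    v ∈ Finsupp.supported (Poly M N) ℂ S ↔ chargeOp (fun μ => if μ ∈ S then 1 else 0) v = v := by
  have key : ∀ (v : Fock M N) μ, chargeOp (fun μ => if μ ∈ S then 1 else 0) v μ =
      if μ ∈ S then v μ else 0 := by
    intro v μ
    induction v using Finsupp.induction_linear with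
    | zero => simp
    | add v w hv hw => rw [map_add, Finsupp.add_apply, hv, hw]; split_ifs <;> simp
    | single ρ p =>
      rw [chargeOp_single, Finsupp.single_apply, Finsupp.single_apply]
      split_ifs <;> simp_all
  rw [Finsupp.mem_supported']
  constructor
  · intro H
    refine Finsupp.ext fun μ => ?_
    rw [key]
    split_ifs with h
    · rfl
    · exact (H μ h).symm
  · intro H μ h
    rw [← H, key, if_neg h]

/-- Operators that commute with all functions of the charge preserve the sectors. -/
theorem preserves_of_lie_eq_zero {S : Set (Charge M N)} {T : Op M N}
    (H : ∀ ε : Charge M N → ℂ, ⁅chargeOp ε, T⁆ = 0) :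
    Preserves M N T (Finsupp.supported (Poly M N) ℂ S) := by
  classical
  intro v hv
  rw [mem_supported_iff_chargeOp] at hv ⊢
  have h1 := LinearMap.congr_fun (H fun μ => if μ ∈ S then 1 else 0) v
  rw [Ring.lie_def] at h1
  simp only [LinearMap.sub_apply, Module.End.mul_apply, LinearMap.zero_apply, hv] at h1
  exact sub_eq_zero.mp h1

theorem preserves_sectorwise {S : Set (Charge M N)} {v : Charge M N} (hS : ∀ μ ∈ S, μ + v ∈ S)
    (T : Charge M N → Module.End ℂ (Poly M N)) :
    Preserves M N (sectorwise M N v T) (Finsupp.supported (Poly M N) ℂ S) := by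
  intro u hu
  rw [← Finsupp.sum_single u, map_finsuppSum]
  refine Submodule.sum_mem _ fun μ hμ => ?_
  dsimp only
  rw [sectorwise_single]
  exact Finsupp.single_mem_supported _ _ (hS μ (hu hμ))

theorem lie_chargeOp_expCoeff (ε : Charge M N → ℂ) {U : ℕ → Op M N}
    (hU : ∀ n, ⁅chargeOp ε, U n⁆ = 0) (k : ℕ) : ⁅chargeOp ε, expCoeff U k⁆ = 0 := by
  have := lie_expCoeff (chargeOp ε) U 0 (fun n _ => by rw [hU]; simp) k
  simpa using this

/-- A vertex operator shifts the charge by the coefficient vector of its zero modes. -/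
theorem preserves_vertex {S : Set (Charge M N)} {Φ : LinField M N}
    (hS : ∀ μ ∈ S, μ + Φ.chg ∈ S) (x : ℂ) :
    Preserves M N (vertex M N τ Φ x) (Finsupp.supported (Poly M N) ℂ S) := by
  intro v hv
  rw [vertex, locSum_apply (isLocFinite_vertexTerm Φ x)]
  refine finsum_induction (fun u => u ∈ Finsupp.supported (Poly M N) ℂ S)
    (Submodule.zero_mem _) (fun _ _ => Submodule.add_mem _) fun k => ?_
  rw [vertexTerm]
  have h0 : ∀ μ ∈ S, μ + 0 ∈ S := fun μ hμ => by rwa [add_zero]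
  exact preserves_of_lie_eq_zero
    (fun ε => lie_chargeOp_expCoeff ε (fun n => lie_chargeOp_mode ε _ _) k.1) _
    (preserves_of_lie_eq_zero
      (fun ε => lie_chargeOp_expCoeff ε (fun n => lie_chargeOp_mode ε _ _) k.2) _
      (preserves_sectorwise hS _ _ (preserves_sectorwise h0 _ _ (preserves_sectorwise h0 _ v hv))))

/-- On the sector of charge `μ` the exponents of `z` in a vertex operator are congruent to
the eigenvalue of its zero mode. -/
theorem vertex_eq_zero {S : Set (Charge M N)} {Φ : LinField M N} {x : ℂ}
    (hS : ∀ μ ∈ S, ∃ n : ℤ, form M N Φ.chg μ = n) (hx : ¬ ∃ n : ℤ, x = n)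
    {v : Fock M N} (hv : v ∈ Finsupp.supported (Poly M N) ℂ S) : vertex M N τ Φ x v = 0 := by
  rw [← Finsupp.sum_single v, map_finsuppSum]
  refine Finset.sum_eq_zero fun μ hμ => ?_
  obtain ⟨n, hn⟩ := hS μ (hv hμ)
  dsimp only
  rw [vertex, locSum_apply (isLocFinite_vertexTerm Φ x), ← finsum_zero (α := ℕ × ℕ)]
  refine finsum_congr fun k => ?_
  rw [vertexTerm, Module.End.mul_apply, zeroPart_single, if_neg, Finsupp.single_zero, map_zero]
  intro h
  refine hx ⟨n + k.1 - k.2, ?_⟩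
  push_cast
  linear_combination hn - h

end Vertex

/-! ### Exponentials of grading operators -/

section Exponential

theorem hasSum_exp_eigenvector {V : Type*} [AddCommGroup V] [Module ℂ V] {D : Module.End ℂ V}
    {v : V} {r : ℂ} (hv : D v = r • v) (f : V →ₗ[ℂ] ℂ) :
    HasSum (fun n : ℕ => f (((n.factorial : ℂ)⁻¹) • (D ^ n) v)) (f (Complex.exp r • v)) := by
  have hpow : ∀ n : ℕ, (D ^ n) v = r ^ n • v := by
    intro n
    induction n with
    | zero => simp
    | succ n ih => rw [pow_succ', Module.End.mul_apply, ih, map_smul, hv, smul_smul, pow_succ]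
  have hs := (NormedSpace.expSeries_div_hasSum_exp r).mul_right (f v)
  rw [← Complex.exp_eq_exp_ℂ] at hs
  simp only [hpow, map_smul, smul_eq_mul]
  exact HasSum.congr_fun hs fun n => by ring

theorem isExpOf_of_span {V : Type*} [AddCommGroup V] [Module ℂ V] {D E : Module.End ℂ V}
    (H : Submodule.span ℂ {v | ∃ r : ℂ, D v = r • v ∧ E v = Complex.exp r • v} = ⊤) :
    IsExpOf D E := by
  intro v f
  have hv : v ∈ Submodule.span ℂ {v | ∃ r : ℂ, D v = r • v ∧ E v = Complex.exp r • v} :=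
    H ▸ Submodule.mem_top
  induction hv using Submodule.span_induction with
  | zero => simp
  | add u w _ _ hu hw => simpa using hu.add hw
  | smul a u _ hu =>
    have := hu.mul_left a
    simp only [map_smul, smul_eq_mul] at this ⊢
    exact HasSum.congr_fun this fun n => by ring
  | mem u hu =>
    obtain ⟨r, h1, h2⟩ := hu
    rw [h2]
    exact hasSum_exp_eigenvector h1 f

/-- An exponential of `D` has the expected eigenvalue on each eigenvector of `D`, since
functionals separate vectors. -/
theorem IsExpOf.apply_eigenvector {V : Type*} [AddCommGroup V] [Module ℂ V]
    {D E : Module.End ℂ V} (H : IsExpOf D E) {v : V} {r : ℂ} (hv : D v = r • v) :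
    E v = Complex.exp r • v := by
  rw [← sub_eq_zero, ← Module.forall_dual_apply_eq_zero_iff ℂ]
  intro f
  rw [map_sub, sub_eq_zero]
  exact (H v f).unique (hasSum_exp_eigenvector hv f)

variable {M N : ℕ} (P : ℕ → Charge M N →ₗ[ℂ] Charge M N)

/-- The exponential of `t • degDer P` for projections `P k`, as an automorphism of the
polynomial algebra. -/
def polyFlow (t : ℂ) : Poly M N →ₐ[ℂ] Poly M N :=
  MvPolynomial.aeval fun x => MvPolynomial.X x +
    (Complex.exp (t * -((x.2 : ℂ) + 1)) - 1) • linPoly M N x.2 (P (x.2 + 1) (Pi.single x.1 1))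

theorem polyFlow_linPoly (t : ℂ) (n : ℕ) (v : Charge M N) :
    polyFlow P t (linPoly M N n v) = linPoly M N n v +
      (Complex.exp (t * -((n : ℂ) + 1)) - 1) • linPoly M N n (P (n + 1) v) := by
  classical
  have hv : v = ∑ s, v s • (Pi.single s 1 : Charge M N) := by
    ext s; simp [Finset.sum_apply, Pi.single_apply]
  conv_rhs => rw [hv]
  rw [linPoly_apply]
  simp only [map_sum, map_smul, polyFlow, MvPolynomial.aeval_X, linPoly_single, Finset.smul_sum,
    smul_add, Finset.sum_add_distrib]
  congr 1
  exact Finset.sum_congr rfl fun s _ => smul_comm _ _ _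

/-- The polynomials on which `degDer P` and all the automorphisms `polyFlow P t` act by
compatible scalars. -/
def polyEigen : Submonoid (Poly M N) where
  carrier := {p | ∃ r : ℂ, degDer P p = r • p ∧ ∀ t, polyFlow P t p = Complex.exp (t * r) • p}
  one_mem' := ⟨0, by simp, by simp⟩
  mul_mem' := by
    rintro p p' ⟨r, h1, h2⟩ ⟨r', h1', h2'⟩
    refine ⟨r + r', ?_, fun t => ?_⟩
    · rw [Derivation.leibniz, h1, h1', smul_eq_mul, smul_eq_mul, mul_smul_comm, mul_smul_comm,
        mul_comm p' p, add_smul, add_comm]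
    · rw [map_mul, h2, h2', smul_mul_smul_comm, ← Complex.exp_add, mul_add]

variable {P}

theorem linPoly_mem_polyEigen_of_fixed {n : ℕ} {v : Charge M N} (hv : P (n + 1) v = v) :
    linPoly M N n v ∈ polyEigen P := by
  refine ⟨-((n : ℂ) + 1), ?_, fun t => ?_⟩
  · rw [degDer_linPoly, hv]
  · rw [polyFlow_linPoly, hv, sub_smul, one_smul]
    abel

theorem linPoly_mem_polyEigen_of_killed {n : ℕ} {v : Charge M N} (hv : P (n + 1) v = 0) :
    linPoly M N n v ∈ polyEigen P := by
  refine ⟨0, ?_, fun t => ?_⟩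
  · rw [degDer_linPoly, hv]
    simp
  · rw [polyFlow_linPoly, hv]
    simp

/-- The products of linear eigenvectors span, as each `P k` is a projection. -/
theorem span_polyEigen (hP : ∀ k v, P (k + 1) (P (k + 1) v) = P (k + 1) v) :
    Submodule.span ℂ (polyEigen P : Set (Poly M N)) = ⊤ := by
  have hspan : Submodule.span ℂ (polyEigen P : Set (Poly M N)) =
      Subalgebra.toSubmodule (Algebra.adjoin ℂ (polyEigen P : Set (Poly M N))) := by
    rw [Algebra.adjoin_eq_span, Submonoid.closure_eq]
  rw [hspan, eq_top_iff]
  intro p _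
  rw [Subalgebra.mem_toSubmodule]
  induction p using MvPolynomial.induction_on with
  | C a => exact Subalgebra.algebraMap_mem _ a
  | add p p' hp hp' => exact Subalgebra.add_mem _ (hp trivial) (hp' trivial)
  | mul_X p x hp =>
    refine Subalgebra.mul_mem _ (hp trivial) ?_
    obtain ⟨s, n⟩ := x
    have : (MvPolynomial.X (s, n) : Poly M N) =
        linPoly M N n (P (n + 1) (Pi.single s 1)) +
          linPoly M N n (Pi.single s 1 - P (n + 1) (Pi.single s 1)) := by
      rw [← map_add, add_sub_cancel, linPoly_single]
    rw [this]
    refine Subalgebra.add_mem _ (Algebra.subset_adjoin ?_) (Algebra.subset_adjoin ?_)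
    · exact linPoly_mem_polyEigen_of_fixed (hP _ _)
    · exact linPoly_mem_polyEigen_of_killed (by rw [map_sub, hP, sub_self])

theorem polyFlow_neg_apply (hP : ∀ k v, P (k + 1) (P (k + 1) v) = P (k + 1) v) (t : ℂ)
    (p : Poly M N) : polyFlow P t (polyFlow P (-t) p) = p := by
  have hp : p ∈ Submodule.span ℂ (polyEigen P : Set (Poly M N)) := by
    rw [span_polyEigen hP]
    trivial
  induction hp using Submodule.span_induction with
  | zero => simp
  | add u w _ _ hu hw => rw [map_add, map_add, hu, hw]
  | smul a u _ hu => rw [map_smul, map_smul, hu]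
  | mem u hu =>
    obtain ⟨r, -, h2⟩ := hu
    rw [h2, map_smul, h2, smul_smul, ← Complex.exp_add, neg_mul, neg_add_cancel, Complex.exp_zero,
      one_smul]

variable (P) in
/-- The exponential of `t • gradOp P ε`. -/
def flow (ε : Charge M N → ℂ) (t : ℂ) : Op M N :=
  sectorwise M N 0 fun μ => Complex.exp (t * ε μ) • (polyFlow P t).toLinearMap

variable (P) in
theorem flow_single (ε : Charge M N → ℂ) (t : ℂ) (μ : Charge M N) (p : Poly M N) :
    flow P ε t (Finsupp.single μ p) =
      Finsupp.single μ (Complex.exp (t * ε μ) • polyFlow P t p) := by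
  simp [flow]

theorem span_eigen (hP : ∀ k v, P (k + 1) (P (k + 1) v) = P (k + 1) v) (ε : Charge M N → ℂ) :
    Submodule.span ℂ {v | ∃ r : ℂ, gradOp P ε v = r • v ∧
      ∀ t, flow P ε t v = Complex.exp (t * r) • v} = ⊤ := by
  rw [eq_top_iff]
  intro v _
  induction v using Finsupp.induction_linear with
  | zero => exact Submodule.zero_mem _
  | add u w hu hw => exact Submodule.add_mem _ (hu trivial) (hw trivial)
  | single μ p =>
    clear * - hP
    have hp : p ∈ Submodule.span ℂ (polyEigen P : Set (Poly M N)) := by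
      rw [span_polyEigen hP]
      trivial
    induction hp using Submodule.span_induction with
    | zero => simp
    | add u w _ _ hu hw => rw [Finsupp.single_add]; exact Submodule.add_mem _ hu hw
    | smul a u _ hu => rw [← Finsupp.smul_single]; exact Submodule.smul_mem _ _ hu
    | mem u hu =>
      obtain ⟨r, h1, h2⟩ := hu
      refine Submodule.subset_span ⟨ε μ + r, ?_, fun t => ?_⟩
      · rw [gradOp_single, h1, Finsupp.smul_single, add_smul]
      · rw [flow_single, h2, Finsupp.smul_single, smul_smul, ← Complex.exp_add, mul_add]

theorem isExpOf_flow (hP : ∀ k v, P (k + 1) (P (k + 1) v) = P (k + 1) v) (ε : Charge M N → ℂ)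
    (t : ℂ) : IsExpOf (t • gradOp P ε) (flow P ε t) := by
  refine isExpOf_of_span (eq_top_iff.mpr ?_)
  rw [← span_eigen hP ε]
  refine Submodule.span_mono ?_
  rintro v ⟨r, h1, h2⟩
  exact ⟨t * r, by rw [LinearMap.smul_apply, h1, smul_smul], h2 t⟩

theorem flow_neg_mul (hP : ∀ k v, P (k + 1) (P (k + 1) v) = P (k + 1) v) (ε : Charge M N → ℂ)
    (t : ℂ) : flow P ε t * flow P ε (-t) = 1 := by
  refine op_ext fun μ p => ?_
  rw [Module.End.mul_apply, flow_single, flow_single, map_smul, polyFlow_neg_apply hP, smul_smul,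
    ← Complex.exp_add, neg_mul, add_neg_cancel, Complex.exp_zero, one_smul, Module.End.one_apply]

/-- `exp (t G)` for `G = gradOp P ε`, as an invertible operator. -/
def flowEquiv (hP : ∀ k v, P (k + 1) (P (k + 1) v) = P (k + 1) v) (ε : Charge M N → ℂ)
    (t : ℂ) : Fock M N ≃ₗ[ℂ] Fock M N :=
  LinearEquiv.ofLinearMap (flow P ε t) (flow P ε (-t)) (flow_neg_mul hP ε t)
    (by have := flow_neg_mul hP ε (-t); rwa [neg_neg] at this)

/-- Homogeneous operators are rescaled under conjugation by the exponential. -/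
theorem flow_conj_of_lie (hP : ∀ k v, P (k + 1) (P (k + 1) v) = P (k + 1) v)
    (ε : Charge M N → ℂ) (t : ℂ) {T : Op M N} {r : ℂ} (hT : ⁅gradOp P ε, T⁆ = r • T) :
    flow P ε t * T * flow P ε (-t) = Complex.exp (t * r) • T := by
  refine LinearMap.ext fun v => ?_
  have hv : v ∈ Submodule.span ℂ {v | ∃ r : ℂ, gradOp P ε v = r • v ∧
      ∀ t, flow P ε t v = Complex.exp (t * r) • v} := by
    rw [span_eigen hP]
    trivial
  induction hv using Submodule.span_induction with
  | zero => simp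
  | add u w _ _ hu hw => rw [map_add, map_add, hu, hw]
  | smul a u _ hu => rw [map_smul, map_smul, hu]
  | mem u hu =>
    obtain ⟨s, h1, h2⟩ := hu
    have h3 := LinearMap.congr_fun hT u
    rw [Ring.lie_def] at h3
    simp only [LinearMap.sub_apply, Module.End.mul_apply, LinearMap.smul_apply, h1, map_smul] at h3
    have h4 : (t • gradOp P ε) (T u) = (t * (s + r)) • T u := by
      rw [LinearMap.smul_apply, mul_smul, add_smul, ← h3]
      congr 1
      abel
    have h5 := (isExpOf_flow hP ε t).apply_eigenvector h4
    simp only [Module.End.mul_apply, LinearMap.smul_apply]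
    rw [h2, map_smul, map_smul, h5, smul_smul, ← Complex.exp_add]
    congr 2
    ring

theorem flow_conj_expQ (hP : ∀ k v, P (k + 1) (P (k + 1) v) = P (k + 1) v)
    {ε : Charge M N → ℂ} {v : Charge M N} {w : ℂ}
    (hε : ∀ μ, ε (μ + v) = ε μ - form M N v μ - w) (t : ℂ) :
    flow P ε t * expQ M N v * flow P ε (-t) =
      Complex.exp (-(t * w)) • (expQ M N v * expZero M N (-t • v)) := by
  refine op_ext fun μ p => ?_
  simp only [Module.End.mul_apply, LinearMap.smul_apply, flow_single, expQ, expZero,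
    sectorwise_single, add_zero, Module.End.one_apply, map_smul, polyFlow_neg_apply hP, smul_smul,
    Finsupp.smul_single, ← Complex.exp_add, hε, zeroVal_eq_form, LinearMap.smul_apply,
    smul_eq_mul]
  congr 3
  ring

end Exponential

/-! ### `q`-integers and the inverse of the Cartan matrix -/

section Cartan

variable {M N : ℕ} {τ : ℂ}

theorem re_neg_of_norm_exp_lt_one (hτ : ‖Complex.exp τ‖ < 1) : τ.re < 0 := by
  rwa [Complex.norm_exp, Real.exp_lt_one_iff] at hτ

theorem qint_ne_zero (hτ : ‖Complex.exp τ‖ < 1) {n : ℤ} (hn : n ≠ 0) : qint τ n ≠ 0 := by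
  have hre := re_neg_of_norm_exp_lt_one hτ
  have key : ∀ k : ℤ, k ≠ 0 → qpow τ k - qpow τ (-k) ≠ 0 := by
    intro k hk h
    have h1 := congrArg (fun z => ‖z‖) (sub_eq_zero.mp h)
    simp only [qpow, Complex.norm_exp, Real.exp_eq_exp] at h1
    have h2 : (τ * (k : ℂ)).re = τ.re * k := by simp
    have h3 : (τ * (-(k : ℂ))).re = -(τ.re * k) := by simp
    rw [h2, h3] at h1
    have h4 : τ.re * k = 0 := by linarith
    rcases mul_eq_zero.mp h4 with h5 | h5
    · exact hre.ne h5
    · exact hk (by exact_mod_cast h5)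
  refine div_ne_zero (key n hn) ?_
  have := key 1 one_ne_zero
  push_cast at this
  exact this

theorem qint_neg (n : ℤ) : qint τ (-n) = -qint τ n := by
  simp only [qint]
  push_cast
  rw [neg_neg]
  ring

/-- The properties of the function `n ↦ [nm]_q`, and of its classical limit `n ↦ n` at `m = 0`,
that enter the inversion of the Cartan matrix. -/
structure IsQuantumInt (f : ℤ → ℂ) (t : ℂ) : Prop where
  zero : f 0 = 0
  recurrence (a : ℤ) : f (a - 1) + f (a + 1) = t * f a
  wronskian (a b : ℤ) : f (a + 1) * f b - f a * f (b - 1) = f (a + b) * f 1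

theorem isQuantumInt_intCast : IsQuantumInt (fun n => (n : ℂ)) 2 where
  zero := by simp
  recurrence a := by push_cast; ring
  wronskian a b := by push_cast; ring

theorem isQuantumInt_qint (τ : ℂ) (m : ℤ) :
    IsQuantumInt (fun n => qint τ (n * m)) (qpow τ m + qpow τ (-m)) where
  zero := by simp [qint]
  recurrence a := by
    simp only [qint, ← add_div, mul_div_assoc']
    congr 1
    simp only [qpow, add_mul, mul_sub, ← Complex.exp_add]
    push_cast
    ring_nf
  wronskian a b := by
    simp only [qint, div_mul_div_comm, div_sub_div_same]
    congr 1
    simp only [qpow, sub_mul, mul_sub, ← Complex.exp_add]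
    push_cast
    ring_nf

/-- The coefficient of `h_m^j` in `h_m^{*i}`. -/
def dualCoeff (M N : ℕ) (τ : ℂ) (m : ℤ) (i j : ℕ) : ℂ :=
  if m = 0 then (alpha M i j : ℂ) * (beta M N i j : ℂ) / ((M : ℂ) - N)
  else qint τ (alpha M i j * m) * qint τ (beta M N i j * m) /
    (qint τ (((M : ℤ) - N) * m) * qint τ m)

theorem dualCoeff_comm (m : ℤ) (i j : ℕ) :
    dualCoeff M N τ m i j = dualCoeff M N τ m j i := by
  simp only [dualCoeff, alpha, beta, min_comm i j, max_comm i j, min_comm (i : ℤ), max_comm (i : ℤ)]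

theorem dualCoeff_neg (m : ℤ) (i j : ℕ) :
    dualCoeff M N τ (-m) i j = dualCoeff M N τ m i j := by
  simp only [dualCoeff, neg_eq_zero, mul_neg, qint_neg, neg_mul, neg_neg]

/-- A common description of the dual coefficients at `m = 0` and `m ≠ 0`. -/
theorem exists_dualCoeff_eq (hMN : M ≠ N) (hτ : ‖Complex.exp τ‖ < 1) (m : ℤ) :
    ∃ f : ℤ → ℂ, IsQuantumInt f (qpow τ m + qpow τ (-m)) ∧ f ((M : ℤ) - N) * f 1 ≠ 0 ∧
      ∀ i j, dualCoeff M N τ m i j =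
        f (alpha M i j) * f (beta M N i j) / (f ((M : ℤ) - N) * f 1) := by
  have hMN' : (M : ℤ) - N ≠ 0 := by omega
  rcases eq_or_ne m 0 with rfl | hm
  · refine ⟨fun n => (n : ℂ), ?_, ?_, fun i j => ?_⟩
    · have : qpow τ (0 : ℤ) + qpow τ (-(0 : ℤ)) = 2 := by simp [qpow]; norm_num
      rw [this]
      exact isQuantumInt_intCast
    · simpa using (by exact_mod_cast hMN' : (M : ℂ) - N ≠ 0)
    · rw [dualCoeff, if_pos rfl]
      push_cast
      rw [mul_one]
  · refine ⟨fun n => qint τ (n * m), isQuantumInt_qint τ m, ?_, fun i j => ?_⟩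
    · exact mul_ne_zero (qint_ne_zero hτ (mul_ne_zero hMN' hm))
        (qint_ne_zero hτ (by simpa using hm))
    · simp only [dualCoeff, if_neg hm, one_mul]

theorem dualCoeff_zero_right (hMN : M ≠ N) (hτ : ‖Complex.exp τ‖ < 1) (m : ℤ) (i : ℕ) :
    dualCoeff M N τ m i 0 = 0 := by
  obtain ⟨f, hf, -, h⟩ := exists_dualCoeff_eq (M := M) (N := N) hMN hτ m
  rw [h, alpha]
  simp [hf.zero]

theorem dualCoeff_last (hN : 1 ≤ N) (hMN : M ≠ N) (hτ : ‖Complex.exp τ‖ < 1) (m : ℤ) {i : ℕ}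
    (hi : i ≤ M + N) : dualCoeff M N τ m i (M + N) = 0 := by
  obtain ⟨f, hf, -, h⟩ := exists_dualCoeff_eq (M := M) (N := N) hMN hτ m
  have : beta M N i (M + N) = 0 := by
    rw [beta, max_eq_right hi, if_neg (by omega)]
    omega
  rw [h, this, hf.zero]
  simp

/-- The dual coefficients invert the tridiagonal Cartan matrix of `sl(M|N)`. Off the diagonal this
is the recurrence for `n ↦ [nm]_q`; on the diagonal it is a Wronskian. -/
theorem cartan_mul_dualCoeff (hMN : M ≠ N) (hτ : ‖Complex.exp τ‖ < 1) (m : ℤ) {i k : ℕ}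
    (hi : 1 ≤ i) (hk : 1 ≤ k) :
    (if i < M then (qpow τ m + qpow τ (-m)) * dualCoeff M N τ m k i
        - dualCoeff M N τ m k (i - 1) - dualCoeff M N τ m k (i + 1)
      else if i = M then dualCoeff M N τ m k (i + 1) - dualCoeff M N τ m k (i - 1)
      else dualCoeff M N τ m k (i - 1) + dualCoeff M N τ m k (i + 1)
        - (qpow τ m + qpow τ (-m)) * dualCoeff M N τ m k i) = if i = k then 1 else 0 := by
  obtain ⟨f, hf, hne, h⟩ := exists_dualCoeff_eq (M := M) (N := N) hMN hτ m
  set t := qpow τ m + qpow τ (-m)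
  set κ := f ((M : ℤ) - N) * f 1
  obtain ⟨i, rfl⟩ : ∃ i', i = i' + 1 := ⟨i - 1, by omega⟩
  rw [Nat.add_sub_cancel]
  -- `a` and `b` are the two solutions of the recurrence, adapted to the two ends of the diagram.
  set a : ℕ → ℂ := fun n => f (if n ≤ M then (n : ℤ) else 2 * M - n) with ha
  set b : ℕ → ℂ := fun n => f (if n ≤ M then (M : ℤ) - N - n else -(M : ℤ) - N + n) with hb
  have hD : ∀ j, dualCoeff M N τ m k j = a (min k j) * b (max k j) / κ := by
    intro j
    simp only [h, alpha, beta, ha, hb, Nat.cast_min, Nat.cast_max]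
  have rec' : ∀ x y z : ℤ, x = y - 1 → z = y + 1 → f x + f z = t * f y := by
    rintro _ y _ rfl rfl
    exact hf.recurrence y
  have wr : ∀ x y z w : ℤ, x = y + 1 → w = z - 1 → y + z = M - N → f x * f z - f y * f w = κ := by
    rintro _ y z _ rfl rfl hyz
    rw [hf.wronskian, hyz]
  have a1 : i + 1 ≠ M → a i + a (i + 1 + 1) = t * a (i + 1) := by
    intro hiM
    rcases lt_or_gt_of_ne hiM with hlt | hgt
    · refine rec' _ _ _ ?_ ?_ <;> split_ifs <;> omega
    · rw [add_comm]
      refine rec' _ _ _ ?_ ?_ <;> split_ifs <;> omega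
  have b1 : i + 1 ≠ M → b i + b (i + 1 + 1) = t * b (i + 1) := by
    intro hiM
    rcases lt_or_gt_of_ne hiM with hlt | hgt
    · rw [add_comm]
      refine rec' _ _ _ ?_ ?_ <;> split_ifs <;> omega
    · refine rec' _ _ _ ?_ ?_ <;> split_ifs <;> omega
  have a2 : i + 1 = M → a (i + 1 + 1) = a i := by
    intro hiM
    simp only [ha]
    congr 1
    split_ifs <;> omega
  have b2 : i + 1 = M → b (i + 1 + 1) = b i := by
    intro hiM
    simp only [hb]
    congr 1
    split_ifs <;> omega
  simp only [hD]
  rcases lt_trichotomy (i + 1) k with hlt | heq | hgt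
  · rw [min_eq_right hlt.le, max_eq_left hlt.le, min_eq_right (by omega : i ≤ k),
      max_eq_left (by omega : i ≤ k), min_eq_right (by omega : i + 1 + 1 ≤ k),
      max_eq_left (by omega : i + 1 + 1 ≤ k), if_neg hlt.ne]
    split_ifs with h1 h2
    · linear_combination (-(b k / κ)) * a1 h1.ne
    · rw [a2 h2, sub_self]
    · linear_combination (b k / κ) * a1 h2
  · subst heq
    rw [min_self, max_self, min_eq_right (by omega : i ≤ i + 1), max_eq_left (by omega : i ≤ i + 1),
      min_eq_left (by omega : i + 1 ≤ i + 1 + 1), max_eq_right (by omega : i + 1 ≤ i + 1 + 1),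
      if_pos rfl]
    split_ifs with h1 h2
    · have w : a (i + 1 + 1) * b (i + 1) - a (i + 1) * b (i + 1 + 1) = κ := by
        refine wr _ _ _ _ ?_ ?_ ?_ <;> split_ifs <;> omega
      field_simp
      linear_combination w - b (i + 1) * a1 h1.ne
    · have w : a (i + 1) * b (i + 1 + 1) - a i * b (i + 1) = κ := by
        refine wr _ _ _ _ ?_ ?_ ?_ <;> split_ifs <;> omega
      field_simp
      linear_combination w
    · have w : a (i + 1) * b (i + 1 + 1) - a (i + 1 + 1) * b (i + 1) = κ := by
        refine wr _ _ _ _ ?_ ?_ ?_ <;> split_ifs <;> omega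
      field_simp
      linear_combination w + b (i + 1) * a1 h2
  · rw [min_eq_left hgt.le, max_eq_right hgt.le, min_eq_left (by omega : k ≤ i),
      max_eq_right (by omega : k ≤ i), min_eq_left (by omega : k ≤ i + 1 + 1),
      max_eq_right (by omega : k ≤ i + 1 + 1), if_neg hgt.ne']
    split_ifs with h1 h2
    · linear_combination (-(a k / κ)) * b1 h1.ne
    · rw [b2 h2, sub_self]
    · linear_combination (a k / κ) * b1 h2

/-! ### The bosons `h^i` and their duals -/

theorem form_eA (k : Fin M) (v : Charge M N) : form M N (eA M N (k + 1)) v = v (.inl k) := by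
  simp [← zeroVal_eq_form, zeroVal, eA, sgn, Fin.val_inj]

theorem form_eB (l : Fin N) (v : Charge M N) :
    form M N (eB M N (l + 1)) v = -v (.inr (.inl l)) := by
  simp [← zeroVal_eq_form, zeroVal, eB, sgn, Fin.val_inj]

theorem form_eC (l : Fin N) (v : Charge M N) :
    form M N (eC M N (l + 1)) v = v (.inr (.inr l)) := by
  simp [← zeroVal_eq_form, zeroVal, eC, sgn, Fin.val_inj]

theorem hVec_natAbs (i : ℕ) (m : ℤ) : hVec M N τ i (m.natAbs : ℤ) = hVec M N τ i m := by
  simp only [hVec, Int.natCast_natAbs, abs_abs]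

theorem hVec_neg (i : ℕ) (m : ℤ) : hVec M N τ i (-m) = hVec M N τ i m := by
  simp only [hVec, abs_neg]

theorem hVec_inl {i : ℕ} (hi : i ≠ 0) (m : ℤ) (k : Fin M) :
    hVec M N τ i m (.inl k) = (if i = k + 1 then qpow τ (-(|m| : ℤ) / 2) else 0)
      - if i = k then qpow τ ((|m| : ℤ) / 2) else 0 := by
  have hk := k.2
  have hi' : 0 < i := Nat.pos_of_ne_zero hi
  rw [hVec]
  split_ifs <;> simp [eA, eB] <;> (try split_ifs) <;> (try omega) <;> simp

theorem hVec_inr_inl (i : ℕ) (m : ℤ) (l : Fin N) :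
    hVec M N τ i m (.inr (.inl l)) = (if i = M + l then qpow τ (-(|m| : ℤ) / 2) else 0)
      - if i = M + l + 1 then qpow τ ((|m| : ℤ) / 2) else 0 := by
  have := l.2
  rw [hVec]
  split_ifs <;> simp [eA, eB] <;> (try split_ifs) <;> (try omega) <;> simp

theorem hVec_inr_inr (i : ℕ) (m : ℤ) (l : Fin N) :
    hVec M N τ i m (.inr (.inr l)) = 0 := by
  rw [hVec]
  split_ifs <;> simp [eA, eB]

/-- The coefficient vector of `h_m^{*i}`. -/
def dualVec (M N : ℕ) (τ : ℂ) (i : ℕ) (m : ℤ) : Charge M N :=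
  ∑ j ∈ Finset.Icc 1 (M + N - 1), dualCoeff M N τ m i j • hVec M N τ j m

theorem hStar_eq_mode (i : ℕ) (m : ℤ) : hStar M N τ i m = mode M N τ (dualVec M N τ i m) m := by
  rw [dualVec, mode_sum, hStar]
  split_ifs with hm
  · subst hm
    simp only [dualCoeff, if_true, h]
  · simp only [dualCoeff, if_neg hm, h]

theorem dualVec_neg (i : ℕ) (m : ℤ) : dualVec M N τ i (-m) = dualVec M N τ i m := by
  simp only [dualVec, dualCoeff_neg, hVec_neg]

/-- The boundary term of the sum at `j = 0`, and in `dualVec_inr_inl` the one at `j = M + N`, may be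
included because the dual coefficient vanishes there. -/
theorem dualVec_inl (hN : 1 ≤ N) (hMN : M ≠ N) (hτ : ‖Complex.exp τ‖ < 1) (i : ℕ)
    (m : ℤ) (k : Fin M) :
    dualVec M N τ i m (.inl k) = qpow τ (-(|m| : ℤ) / 2) * dualCoeff M N τ m i (k + 1)
      - qpow τ ((|m| : ℤ) / 2) * dualCoeff M N τ m i k := by
  have hk := k.2
  rw [dualVec, Finset.sum_apply]
  simp only [Pi.smul_apply, smul_eq_mul]
  rw [Finset.sum_congr rfl fun j hj => by
    rw [hVec_inl (Nat.one_le_iff_ne_zero.mp (Finset.mem_Icc.mp hj).1)]]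
  simp only [mul_sub, mul_ite, mul_zero, Finset.sum_sub_distrib, Finset.sum_ite_eq',
    Finset.mem_Icc]
  rw [if_pos (by omega)]
  split_ifs with h0
  · ring
  · have : (k : ℕ) = 0 := by omega
    rw [this, dualCoeff_zero_right hMN hτ]
    ring

theorem dualVec_inr_inl (hM : 1 ≤ M) (hMN : M ≠ N) (hτ : ‖Complex.exp τ‖ < 1) {i : ℕ}
    (hi : i ≤ M + N) (m : ℤ) (l : Fin N) :
    dualVec M N τ i m (.inr (.inl l)) = qpow τ (-(|m| : ℤ) / 2) * dualCoeff M N τ m i (M + l)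
      - qpow τ ((|m| : ℤ) / 2) * dualCoeff M N τ m i (M + l + 1) := by
  have hl := l.2
  rw [dualVec, Finset.sum_apply]
  simp only [Pi.smul_apply, smul_eq_mul, hVec_inr_inl]
  simp only [mul_sub, mul_ite, mul_zero, Finset.sum_sub_distrib, Finset.sum_ite_eq',
    Finset.mem_Icc]
  rw [if_pos (by omega)]
  split_ifs with h0
  · ring
  · have : M + (l : ℕ) + 1 = M + N := by omega
    rw [this, dualCoeff_last (by omega) hMN hτ _ hi]
    ring

theorem dualVec_inr_inr (i : ℕ) (m : ℤ) (l : Fin N) : dualVec M N τ i m (.inr (.inr l)) = 0 := by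
  simp [dualVec, hVec_inr_inr]

/-- Pairing with `h_m^i` a vector whose entries are twisted differences of a sequence `g`, as are
those of `h_m^{*k}`, applies the tridiagonal Cartan matrix to `g`. -/
theorem form_hVec_apply {i : ℕ} (hi : 1 ≤ i) (hi' : i ≤ M + N - 1) (m : ℤ) {v : Charge M N}
    {g : ℕ → ℂ}
    (h1 : ∀ k : Fin M, v (.inl k) = qpow τ (-(|m| : ℤ) / 2) * g (k + 1)
      - qpow τ ((|m| : ℤ) / 2) * g k)
    (h2 : ∀ l : Fin N, v (.inr (.inl l)) = qpow τ (-(|m| : ℤ) / 2) * g (M + l)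
      - qpow τ ((|m| : ℤ) / 2) * g (M + l + 1)) :
    form M N (hVec M N τ i m) v =
      if i < M then (qpow τ m + qpow τ (-m)) * g i - g (i - 1) - g (i + 1)
      else if i = M then g (i + 1) - g (i - 1)
      else g (i - 1) + g (i + 1) - (qpow τ m + qpow τ (-m)) * g i := by
  have t1 : qpow τ (-(|m| : ℤ) / 2) * qpow τ ((|m| : ℤ) / 2) = 1 := by
    rw [qpow, qpow, ← Complex.exp_add, ← Complex.exp_zero]
    congr 1
    ring
  have t2 : qpow τ (-(|m| : ℤ) / 2) * qpow τ (-(|m| : ℤ) / 2) +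
      qpow τ ((|m| : ℤ) / 2) * qpow τ ((|m| : ℤ) / 2) = qpow τ m + qpow τ (-m) := by
    simp only [qpow, ← Complex.exp_add]
    rcases abs_choice m with h | h <;> rw [h] <;> push_cast
    · rw [add_comm]
      congr 2 <;> ring
    · congr 2 <;> ring
  rw [hVec]
  set x := qpow τ (-(|m| : ℤ) / 2)
  set y := qpow τ ((|m| : ℤ) / 2)
  split_ifs with hlt heq
  · have e1 := form_eA (N := N) ⟨i - 1, by omega⟩ v
    have e2 := form_eA (N := N) ⟨i, hlt⟩ v
    rw [h1] at e1 e2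
    simp only [Nat.sub_add_cancel hi] at e1 e2
    simp only [map_sub, map_smul, LinearMap.sub_apply, LinearMap.smul_apply, smul_eq_mul, e1, e2]
    linear_combination g i * t2 - (g (i - 1) + g (i + 1)) * t1
  · subst heq
    have e1 := form_eA (N := N) ⟨i - 1, by omega⟩ v
    have e2 := form_eB (M := i) ⟨0, by omega⟩ v
    rw [h1] at e1
    rw [h2] at e2
    simp only [Nat.sub_add_cancel hi, zero_add, add_zero] at e1 e2
    simp only [map_add, map_smul, LinearMap.add_apply, LinearMap.smul_apply, smul_eq_mul, e1, e2]
    linear_combination (g (i + 1) - g (i - 1)) * t1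
  · obtain ⟨j, rfl⟩ : ∃ j, i = M + (j + 1) := ⟨i - M - 1, by omega⟩
    have e1 := form_eB (M := M) ⟨j, by omega⟩ v
    have e2 := form_eB (M := M) ⟨j + 1, by omega⟩ v
    rw [h2] at e1 e2
    rw [show M + (j + 1) - M = j + 1 by omega, show M + (j + 1) + 1 - M = j + 1 + 1 by omega,
      show M + (j + 1) - 1 = M + j by omega]
    simp only [map_add, map_neg, map_smul, LinearMap.add_apply, LinearMap.neg_apply,
      LinearMap.smul_apply, smul_eq_mul, e1, e2, ← add_assoc]
    linear_combination (g (M + j) + g (M + j + 1 + 1)) * t1 - g (M + j + 1) * t2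

theorem form_hVec_dualVec (hMN : M ≠ N) (hM : 1 ≤ M) (hN : 1 ≤ N) (hτ : ‖Complex.exp τ‖ < 1)
    (m : ℤ) {i k : ℕ} (hi : i ∈ Finset.Icc 1 (M + N - 1)) (hk : k ∈ Finset.Icc 1 (M + N - 1)) :
    form M N (hVec M N τ i m) (dualVec M N τ k m) = if i = k then 1 else 0 := by
  rw [Finset.mem_Icc] at hi hk
  rw [form_hVec_apply hi.1 hi.2 m (dualVec_inl hN hMN hτ k m)
    (dualVec_inr_inl hM hMN hτ (by omega) m)]
  exact cartan_mul_dualCoeff hMN hτ m hi.1 hk.1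

end Cartan

/-! ### The grading operator as a homogeneous quadratic operator -/

section Projection

variable {M N : ℕ} {τ : ℂ}

/-- The projection onto the coefficient vectors of the bosons `h_k^i` and `c_k^j`, orthogonal for
the form `zeroVal`; its kernel is spanned by the boson that commutes with all of them. -/
def proj (M N : ℕ) (τ : ℂ) (k : ℕ) : Charge M N →ₗ[ℂ] Charge M N :=
  ∑ i ∈ Finset.Icc 1 (M + N - 1),
      (form M N (dualVec M N τ i k)).smulRight (hVec M N τ i k) +
    ∑ j ∈ Finset.Icc 1 N, (form M N (eC M N j)).smulRight (eC M N j)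

theorem proj_apply (k : ℕ) (v : Charge M N) :
    proj M N τ k v =
      ∑ i ∈ Finset.Icc 1 (M + N - 1), form M N (dualVec M N τ i k) v • hVec M N τ i k +
        ∑ j ∈ Finset.Icc 1 N, form M N (eC M N j) v • eC M N j := by
  simp [proj]

/-- The tensor `∑ h^i ⊗ h^{*i}` is symmetric, since the matrix of dual coefficients is. -/
theorem sum_form_hVec_smul_dualVec (m : ℤ) (v : Charge M N) :
    ∑ i ∈ Finset.Icc 1 (M + N - 1), form M N (hVec M N τ i m) v • dualVec M N τ i m =
      ∑ i ∈ Finset.Icc 1 (M + N - 1), form M N (dualVec M N τ i m) v • hVec M N τ i m := by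
  simp only [dualVec, Finset.smul_sum, map_sum, map_smul, LinearMap.sum_apply,
    LinearMap.smul_apply, Finset.sum_smul, smul_smul, smul_eq_mul]
  rw [Finset.sum_comm]
  refine Finset.sum_congr rfl fun i _ => Finset.sum_congr rfl fun j _ => ?_
  rw [dualCoeff_comm m j i, mul_comm]

theorem form_proj (k : ℕ) (u v : Charge M N) :
    form M N (proj M N τ k u) v = form M N u (proj M N τ k v) := by
  rw [proj_apply k v, ← sum_form_hVec_smul_dualVec, proj_apply k u]
  simp only [map_add, map_sum, map_smul, LinearMap.add_apply, LinearMap.sum_apply,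
    LinearMap.smul_apply, smul_eq_mul]
  congr 1 <;> refine Finset.sum_congr rfl fun i _ => ?_
  · rw [form_comm u, mul_comm]
  · rw [form_comm u, mul_comm]

theorem form_eC_of_mem {j : ℕ} (hj : j ∈ Finset.Icc 1 N) (v : Charge M N) :
    ∃ l : Fin N, (l : ℕ) + 1 = j ∧ form M N (eC M N j) v = v (.inr (.inr l)) := by
  rw [Finset.mem_Icc] at hj
  refine ⟨⟨j - 1, by omega⟩, by simp only []; omega, ?_⟩
  have := form_eC (M := M) ⟨j - 1, by omega⟩ v
  rwa [Nat.sub_add_cancel hj.1] at this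

theorem form_eC_hVec {j : ℕ} (hj : j ∈ Finset.Icc 1 N) (i : ℕ) (m : ℤ) :
    form M N (eC M N j) (hVec M N τ i m) = 0 := by
  obtain ⟨l, -, hl⟩ := form_eC_of_mem hj (hVec M N τ i m)
  rw [hl, hVec_inr_inr]

theorem form_eC_dualVec {j : ℕ} (hj : j ∈ Finset.Icc 1 N) (i : ℕ) (m : ℤ) :
    form M N (eC M N j) (dualVec M N τ i m) = 0 := by
  obtain ⟨l, -, hl⟩ := form_eC_of_mem hj (dualVec M N τ i m)
  rw [hl, dualVec_inr_inr]

theorem form_eC_eC {j : ℕ} (hj : j ∈ Finset.Icc 1 N) (k : ℕ) :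
    form M N (eC M N j) (eC M N k) = if j = k then 1 else 0 := by
  obtain ⟨l, rfl, hl⟩ := form_eC_of_mem hj (eC M N k)
  rw [hl]
  rfl

theorem proj_eC (k : ℕ) {j : ℕ} (hj : j ∈ Finset.Icc 1 N) :
    proj M N τ k (eC M N j) = eC M N j := by
  rw [proj_apply, Finset.sum_eq_zero, zero_add, Finset.sum_eq_single_of_mem j hj]
  · rw [form_eC_eC hj, if_pos rfl, one_smul]
  · intro i hi hij
    rw [form_eC_eC hi, if_neg hij, zero_smul]
  · intro i _
    rw [form_comm, form_eC_dualVec hj, zero_smul]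

theorem proj_hVec (hM : 1 ≤ M) (hN : 1 ≤ N) (hMN : M ≠ N) (hτ : ‖Complex.exp τ‖ < 1) (m : ℤ)
    {i : ℕ} (hi : i ∈ Finset.Icc 1 (M + N - 1)) :
    proj M N τ m.natAbs (hVec M N τ i m) = hVec M N τ i m := by
  rw [← hVec_natAbs]
  rw [proj_apply, Finset.sum_eq_single_of_mem i hi, Finset.sum_eq_zero, add_zero]
  · rw [form_comm, form_hVec_dualVec hMN hM hN hτ _ hi hi, if_pos rfl, one_smul]
  · intro j hj
    rw [form_eC_hVec hj, zero_smul]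
  · intro k hk hki
    rw [form_comm, form_hVec_dualVec hMN hM hN hτ _ hi hk, if_neg (Ne.symm hki), zero_smul]

theorem proj_proj (hM : 1 ≤ M) (hN : 1 ≤ N) (hMN : M ≠ N) (hτ : ‖Complex.exp τ‖ < 1) (k : ℕ)
    (v : Charge M N) : proj M N τ k (proj M N τ k v) = proj M N τ k v := by
  conv_lhs => rw [proj_apply k v]
  rw [proj_apply k v, map_add, map_sum, map_sum]
  congr 1 <;> refine Finset.sum_congr rfl fun i hi => ?_
  · have := proj_hVec hM hN hMN hτ k hi
    rw [Int.natAbs_natCast] at this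
    rw [map_smul, this]
  · rw [map_smul, proj_eC k hi]

/-! ### The oscillator part -/

/-- The derivation by which each of the two terms of index `±(n+1)` of the infinite sum in the
grading operator acts. -/
def termDer (M N : ℕ) (τ : ℂ) (n : ℕ) : Derivation ℂ (Poly M N) (Poly M N) :=
  MvPolynomial.mkDerivation ℂ fun x =>
    if x.2 = n then ((n : ℂ) + 1) • linPoly M N n (proj M N τ (n + 1) (Pi.single x.1 1)) else 0

/-- A sum of products of creation and annihilation modes of index `±(n+1)` acts by `termDer` if
its coefficient tensor is that of the projection. -/
theorem sum_linPoly_mul_annDer (hτ : ‖Complex.exp τ‖ < 1) (n : ℕ) (u w : ℕ → Charge M N)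
    (huw : ∀ v, ∑ i ∈ Finset.Icc 1 (M + N - 1), form M N (w i) v • u i +
      ∑ j ∈ Finset.Icc 1 N, form M N (eC M N j) v • eC M N j = proj M N τ (n + 1) v)
    (p : Poly M N) :
    (((n : ℂ) + 1) ^ 2 / qint τ (n + 1) ^ 2) •
      (∑ i ∈ Finset.Icc 1 (M + N - 1), linPoly M N n (u i) * annDer τ n (w i) p +
        ∑ j ∈ Finset.Icc 1 N, linPoly M N n (eC M N j) * annDer τ n (eC M N j) p) =
      termDer M N τ n p := by
  have hq : qint τ (n + 1) ≠ 0 := by exact_mod_cast qint_ne_zero hτ (by omega : (n : ℤ) + 1 ≠ 0)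
  have hn : (n : ℂ) + 1 ≠ 0 := by exact_mod_cast n.succ_ne_zero
  have hab : ∀ (a : ℂ) (b : Poly M N), (((n : ℂ) + 1) ^ 2 / qint τ (n + 1) ^ 2) •
      (b * MvPolynomial.C (qint τ (n + 1) ^ 2 / (n + 1) * a)) = ((n : ℂ) + 1) • a • b := by
    intro a b
    rw [mul_comm, ← MvPolynomial.smul_eq_C_mul, smul_smul, smul_smul]
    congr 1
    field_simp
  have key : (((n : ℂ) + 1) ^ 2 / qint τ (n + 1) ^ 2) •
      (∑ i ∈ Finset.Icc 1 (M + N - 1), linPoly M N n (u i) • annDer τ n (w i) +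
        ∑ j ∈ Finset.Icc 1 N, linPoly M N n (eC M N j) • annDer τ n (eC M N j)) =
      termDer M N τ n := by
    refine MvPolynomial.derivation_ext fun x => ?_
    obtain ⟨s, n'⟩ := x
    simp only [Derivation.smul_apply, Derivation.add_apply, derivation_sum_apply, annDer_X,
      termDer, MvPolynomial.mkDerivation_X]
    split_ifs with h
    · simp only [← huw, map_add, map_sum, map_smul, smul_add, Finset.smul_sum, smul_eq_mul]
      congr 1 <;> exact Finset.sum_congr rfl fun i _ => hab _ _
    · simp
  rw [← key]
  simp only [Derivation.smul_apply, Derivation.add_apply, derivation_sum_apply, smul_eq_mul]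

theorem gradingTerm_pos_single (hτ : ‖Complex.exp τ‖ < 1) (n : ℕ) (hn : (n : ℤ) + 1 ≠ 0)
    (μ : Charge M N) (p : Poly M N) :
    gradingTerm M N τ ⟨(n : ℤ) + 1, hn⟩ (Finsupp.single μ p) =
      Finsupp.single μ (termDer M N τ n p) := by
  have hneg : -((n : ℤ) + 1) < 0 := by omega
  rw [← sum_linPoly_mul_annDer hτ n (fun i => hVec M N τ i ((n : ℤ) + 1))
    (fun i => dualVec M N τ i ((n : ℤ) + 1)) (fun v => by rw [proj_apply]; push_cast; rfl)]
  simp only [gradingTerm, normOrd, if_pos hneg, hStar_eq_mode, h, c, LinearMap.smul_apply,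
    LinearMap.add_apply, LinearMap.sum_apply, Module.End.mul_apply, mode_pos_single,
    mode_neg_single, hVec_neg, ← Finsupp.smul_single]
  push_cast
  rw [Finsupp.single_add]
  congr 2
  · exact (map_sum (Finsupp.singleAddHom μ) _ _).symm
  · exact (map_sum (Finsupp.singleAddHom μ) _ _).symm

theorem gradingTerm_neg_single (hτ : ‖Complex.exp τ‖ < 1) (n : ℕ) (hn : -((n : ℤ) + 1) ≠ 0)
    (μ : Charge M N) (p : Poly M N) :
    gradingTerm M N τ ⟨-((n : ℤ) + 1), hn⟩ (Finsupp.single μ p) =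
      Finsupp.single μ (termDer M N τ n p) := by
  have hneg : ¬ (n : ℤ) + 1 < 0 := by omega
  rw [← sum_linPoly_mul_annDer hτ n (fun i => dualVec M N τ i ((n : ℤ) + 1))
    (fun i => hVec M N τ i ((n : ℤ) + 1))
    (fun v => by rw [proj_apply, sum_form_hVec_smul_dualVec]; push_cast; rfl)]
  simp only [gradingTerm, normOrd, neg_neg, if_neg hneg, hStar_eq_mode, h, c,
    LinearMap.smul_apply, LinearMap.add_apply, LinearMap.sum_apply, Module.End.mul_apply,
    mode_pos_single, mode_neg_single, dualVec_neg, ← Finsupp.smul_single, qint_neg]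
  push_cast
  rw [Finsupp.single_add, neg_sq, neg_sq]
  congr 2
  · exact (map_sum (Finsupp.singleAddHom μ) _ _).symm
  · exact (map_sum (Finsupp.singleAddHom μ) _ _).symm

/-- Polynomials in the modes of index above `-(K+1)` are killed by the later terms, and on them
the first terms add up to minus the degree derivation. -/
theorem exists_sum_termDer (τ : ℂ) (p : Poly M N) :
    ∃ K, (∀ n, K ≤ n → termDer M N τ n p = 0) ∧
      ∑ n ∈ Finset.range K, termDer M N τ n p = -degDer (proj M N τ) p := by
  classical
  obtain ⟨K, hK⟩ : ∃ K, ∀ x ∈ p.vars, x.2 < K :=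
    ⟨p.vars.sup Prod.snd + 1, fun x hx =>
      Nat.lt_succ_of_le (Finset.le_sup (f := Prod.snd) hx)⟩
  refine ⟨K, fun n hn => ?_, ?_⟩
  · refine MvPolynomial.derivation_eq_zero_of_forall_mem_vars fun x hx => ?_
    rw [termDer, MvPolynomial.mkDerivation_X, if_neg]
    have := hK x hx
    omega
  · rw [← derivation_sum_apply, ← Derivation.neg_apply]
    refine MvPolynomial.derivation_eq_of_forall_mem_vars fun x hx => ?_
    simp only [derivation_sum_apply, Derivation.neg_apply, termDer, degDer,
      MvPolynomial.mkDerivation_X, Finset.sum_ite_eq, Finset.mem_range, hK x hx, if_true,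
      neg_smul, neg_neg]

theorem gradingTerm_support (hτ : ‖Complex.exp τ‖ < 1) (μ : Charge M N) {p : Poly M N} {K : ℕ}
    (hK : ∀ n, K ≤ n → termDer M N τ n p = 0) :
    (Function.support fun m => gradingTerm M N τ m (Finsupp.single μ p)) ⊆
      {m | m.1.natAbs ≤ K} := by
  rintro ⟨m, hm⟩ hsupp
  obtain ⟨n, rfl | rfl⟩ := int_ne_zero_cases hm
  · rw [Function.mem_support, gradingTerm_pos_single hτ] at hsupp
    by_contra hlt
    refine hsupp ?_
    rw [hK n, Finsupp.single_zero]
    simp only [Set.mem_ofPred_eq] at hlt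
    omega
  · rw [Function.mem_support, gradingTerm_neg_single hτ] at hsupp
    by_contra hlt
    refine hsupp ?_
    rw [hK n, Finsupp.single_zero]
    simp only [Set.mem_ofPred_eq] at hlt
    omega

theorem isLocFinite_gradingTerm (hτ : ‖Complex.exp τ‖ < 1) :
    IsLocFinite (gradingTerm M N τ) := by
  refine isLocFinite_of_monomial fun μ d a => ?_
  obtain ⟨K, hK, -⟩ := exists_sum_termDer τ (MvPolynomial.monomial d a)
  refine Set.Finite.subset ?_ (gradingTerm_support hτ μ hK)
  refine Set.Finite.of_finite_image (f := Subtype.val)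
    ((Set.finite_Icc (-(K : ℤ)) K).subset ?_) Subtype.val_injective.injOn
  rintro _ ⟨m, hm, rfl⟩
  simp only [Set.mem_ofPred_eq] at hm
  rw [Set.mem_Icc]
  omega

theorem locSum_gradingTerm_single (hτ : ‖Complex.exp τ‖ < 1) (μ : Charge M N) (p : Poly M N) :
    locSum (gradingTerm M N τ) (Finsupp.single μ p) =
      Finsupp.single μ (-(2 : ℂ) • degDer (proj M N τ) p) := by
  classical
  obtain ⟨K, hK, hsum⟩ := exists_sum_termDer τ p
  rw [locSum_apply (isLocFinite_gradingTerm hτ)]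
  obtain ⟨f, hfl, hfr⟩ : ∃ f : ℕ ⊕ ℕ ↪ {m : ℤ // m ≠ 0},
      (∀ n : ℕ, f (.inl n) = ⟨(n : ℤ) + 1, by omega⟩) ∧
        ∀ n : ℕ, f (.inr n) = ⟨-((n : ℤ) + 1), by omega⟩ := by
    refine ⟨⟨Sum.elim (fun n => ⟨(n : ℤ) + 1, by omega⟩) (fun n => ⟨-((n : ℤ) + 1), by omega⟩), ?_⟩,
      fun _ => rfl, fun _ => rfl⟩
    rintro (a | a) (b | b) hab <;> have hab := congrArg Subtype.val hab <;> dsimp at hab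
    · rw [show a = b by omega]
    · omega
    · omega
    · rw [show a = b by omega]
  rw [finsum_eq_sum_of_support_subset (s := ((Finset.range K).disjSum (Finset.range K)).map f)]
  · rw [Finset.sum_map, Finset.sum_disjSum]
    simp only [hfl, hfr, gradingTerm_pos_single hτ, gradingTerm_neg_single hτ]
    have e : ∑ n ∈ Finset.range K, (Finsupp.single μ (termDer M N τ n p) : Fock M N) =
        Finsupp.single μ (-degDer (proj M N τ) p) := by
      rw [← hsum]
      exact (map_sum (Finsupp.singleAddHom μ) _ _).symm
    rw [e, ← Finsupp.single_add, neg_smul, two_smul, neg_add]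
  · rintro ⟨m, hm⟩ hsupp
    obtain ⟨n, rfl | rfl⟩ := int_ne_zero_cases hm
    · have hn : n < K := by
        by_contra hlt
        rw [Function.mem_support, gradingTerm_pos_single hτ, hK n (by omega)] at hsupp
        simp at hsupp
      rw [Finset.mem_coe, Finset.mem_map]
      exact ⟨Sum.inl n, by simpa using hn, hfl n⟩
    · have hn : n < K := by
        by_contra hlt
        rw [Function.mem_support, gradingTerm_neg_single hτ, hK n (by omega)] at hsupp
        simp at hsupp
      rw [Finset.mem_coe, Finset.mem_map]
      exact ⟨Sum.inr n, by simpa using hn, hfr n⟩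

/-! ### The zero mode part -/

/-- The eigenvalue of the grading operator on the vacuum of charge `μ`. -/
def vacEnergy (M N : ℕ) (τ : ℂ) (μ : Charge M N) : ℂ :=
  -(1 / 2) * (form M N (proj M N τ 0 μ) μ + ∑ j ∈ Finset.Icc 1 N, form M N (eC M N j) μ)

/-- The conformal weight of `e^{∑ v_s Q_s}`. -/
def weight (M N : ℕ) (v : Charge M N) : ℂ :=
  1 / 2 * (form M N v v + ∑ j ∈ Finset.Icc 1 N, form M N (eC M N j) v)

theorem vacEnergy_add {v : Charge M N} (hv : proj M N τ 0 v = v) (μ : Charge M N) :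
    vacEnergy M N τ (μ + v) = vacEnergy M N τ μ - form M N v μ - weight M N v := by
  have h1 : form M N (proj M N τ 0 μ) v = form M N v μ := by
    rw [form_proj, hv, form_comm]
  simp only [vacEnergy, weight, map_add, LinearMap.add_apply, hv, h1, Finset.sum_add_distrib]
  ring

theorem gradingOp_eq (hτ : ‖Complex.exp τ‖ < 1) :
    gradingOp M N τ = gradOp (proj M N τ) (vacEnergy M N τ) := by
  refine op_ext fun μ p => ?_
  have e1 : ∀ i, (h M N τ i 0 * hStar M N τ i 0) (Finsupp.single μ p) =
      Finsupp.single μ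
        ((form M N (dualVec M N τ i 0) μ * form M N (hVec M N τ i 0) μ) • p) := fun i => by
    rw [hStar_eq_mode, h, Module.End.mul_apply, mode_zero_single, mode_zero_single, smul_smul,
      mul_comm]
  have e2 : ∀ j, (c M N τ j 0 * (c M N τ j 0 + 1)) (Finsupp.single μ p) =
      Finsupp.single μ ((form M N (eC M N j) μ * form M N (eC M N j) μ +
        form M N (eC M N j) μ) • p) := fun j => by
    rw [c, Module.End.mul_apply, LinearMap.add_apply, Module.End.one_apply, mode_zero_single,
      ← Finsupp.single_add, mode_zero_single, smul_add, smul_smul, add_smul]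
  have e3 : form M N (proj M N τ 0 μ) μ =
      ∑ i ∈ Finset.Icc 1 (M + N - 1),
        form M N (dualVec M N τ i 0) μ * form M N (hVec M N τ i 0) μ +
      ∑ j ∈ Finset.Icc 1 N, form M N (eC M N j) μ * form M N (eC M N j) μ := by
    rw [proj_apply]
    simp
  rw [gradingOp, gradOp_single]
  simp only [LinearMap.sub_apply, LinearMap.smul_apply, LinearMap.add_apply, LinearMap.sum_apply,
    locSum_gradingTerm_single hτ, e1, e2]
  have e4 : ∀ (t : Finset ℕ) (g : ℕ → ℂ),
      ∑ i ∈ t, (Finsupp.single μ (g i • p) : Fock M N) =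
        Finsupp.single μ ((∑ i ∈ t, g i) • p) := fun t g => by
    rw [Finset.sum_smul]
    exact (map_sum (Finsupp.singleAddHom μ) _ _).symm
  rw [e4, e4, ← Finsupp.single_add, Finsupp.smul_single, Finsupp.smul_single, ← Finsupp.single_sub,
    vacEnergy, e3, Finset.sum_add_distrib]
  congr 1
  module

end Projection

/-! ### Weights and root vectors -/

section Currents

variable {M N : ℕ} {τ : ℂ}

theorem qpow_zero : qpow τ 0 = 1 := by simp [qpow]

theorem form_hVec_of_lt (τ : ℂ) {k : ℕ} (hk : k + 1 < M) (v : Charge M N) :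
    form M N (hVec M N τ (k + 1) 0) v =
      v (.inl ⟨k, by omega⟩) - v (.inl ⟨k + 1, hk⟩) := by
  have e1 := form_eA (N := N) ⟨k, by omega⟩ v
  have e2 := form_eA (N := N) ⟨k + 1, hk⟩ v
  rw [hVec, if_pos hk]
  simp only [abs_zero, Int.cast_zero, neg_zero, zero_div, qpow_zero, one_smul, map_sub,
    LinearMap.sub_apply]
  rw [e1, e2]

theorem form_hVec_self (τ : ℂ) (hM : 1 ≤ M) (hN : 1 ≤ N) (v : Charge M N) :
    form M N (hVec M N τ M 0) v =
      v (.inl ⟨M - 1, by omega⟩) - v (.inr (.inl ⟨0, hN⟩)) := by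
  have e1 := form_eA (N := N) ⟨M - 1, by omega⟩ v
  have e2 := form_eB (M := M) ⟨0, hN⟩ v
  simp only [Nat.sub_add_cancel hM, zero_add] at e1 e2
  rw [hVec, if_neg (lt_irrefl M), if_pos rfl]
  simp only [abs_zero, Int.cast_zero, neg_zero, zero_div, qpow_zero, one_smul, map_add,
    LinearMap.add_apply]
  rw [e1, e2, sub_eq_add_neg]

theorem form_hVec_of_gt (τ : ℂ) {l : ℕ} (hl : l + 1 < N) (v : Charge M N) :
    form M N (hVec M N τ (M + l + 1) 0) v =
      v (.inr (.inl ⟨l, by omega⟩)) - v (.inr (.inl ⟨l + 1, hl⟩)) := by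
  have e1 := form_eB (M := M) ⟨l, by omega⟩ v
  have e2 := form_eB (M := M) ⟨l + 1, hl⟩ v
  rw [hVec, if_neg (by omega), if_neg (by omega), show M + l + 1 - M = l + 1 by omega,
    show M + l + 1 + 1 - M = l + 1 + 1 by omega]
  simp only [abs_zero, Int.cast_zero, neg_zero, zero_div, qpow_zero, one_smul, map_add, map_neg,
    LinearMap.add_apply, LinearMap.neg_apply]
  rw [e1, e2]
  ring

/-- The three kinds of nodes of the Dynkin diagram. -/
theorem node_cases {i : ℕ} (hi : i ∈ Finset.Icc 1 (M + N - 1)) :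
    (∃ k, k + 1 < M ∧ i = k + 1) ∨ i = M ∨ ∃ l, l + 1 < N ∧ i = M + l + 1 := by
  rw [Finset.mem_Icc] at hi
  rcases lt_trichotomy i M with h | h | h
  · exact Or.inl ⟨i - 1, by omega, by omega⟩
  · exact Or.inr (Or.inl h)
  · exact Or.inr (Or.inr ⟨i - M - 1, by omega, by omega⟩)

theorem form_hVec_hVec (τ : ℂ) (hM : 1 ≤ M) (hN : 1 ≤ N) {i : ℕ}
    (hi : i ∈ Finset.Icc 1 (M + N - 1)) :
    form M N (hVec M N τ i 0) (hVec M N τ i 0) =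
      if i < M then 2 else if i = M then 0 else -2 := by
  rcases node_cases hi with ⟨k, hk, rfl⟩ | rfl | ⟨l, hl, rfl⟩
  · rw [form_hVec_of_lt τ hk, hVec_inl (by omega), hVec_inl (by omega), if_pos hk]
    simp [qpow_zero]
    norm_num
  · rw [form_hVec_self τ hM hN, hVec_inl (by omega), hVec_inr_inl, if_neg (lt_irrefl _),
      if_pos rfl, if_pos (by simp; omega), if_neg (by omega), if_pos (by simp),
      if_neg (by simp)]
    ring
  · rw [form_hVec_of_gt τ hl, hVec_inr_inl, hVec_inr_inl, if_neg (by omega : ¬ M + l + 1 < M),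
      if_neg (by omega : ¬ M + l + 1 = M), if_neg (by simp), if_pos (by simp),
      if_pos (by simp; omega), if_neg (by simp)]
    simp [qpow_zero]
    norm_num

theorem weight_add {u v : Charge M N} (huv : form M N u v = 0) :
    weight M N (u + v) = weight M N u + weight M N v := by
  have hvu : form M N v u = 0 := by rw [form_comm, huv]
  simp only [weight, map_add, LinearMap.add_apply, huv, hvu, Finset.sum_add_distrib]
  ring

theorem weight_hVec (τ : ℂ) (hM : 1 ≤ M) (hN : 1 ≤ N) {i : ℕ}
    (hi : i ∈ Finset.Icc 1 (M + N - 1)) :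
    weight M N (hVec M N τ i 0) = if i < M then 1 else if i = M then 0 else -1 := by
  rw [weight, form_hVec_hVec τ hM hN hi, Finset.sum_eq_zero fun j hj => form_eC_hVec hj i 0]
  split_ifs <;> norm_num

theorem weight_neg_hVec (τ : ℂ) (i : ℕ) :
    weight M N (-hVec M N τ i 0) = weight M N (hVec M N τ i 0) := by
  have h0 := fun j (hj : j ∈ Finset.Icc 1 N) => form_eC_hVec (M := M) (τ := τ) hj i 0
  have h1 := fun j (hj : j ∈ Finset.Icc 1 N) =>
    (show form M N (eC M N j) (-hVec M N τ i 0) = 0 by rw [map_neg, h0 j hj, neg_zero])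
  rw [weight, weight, Finset.sum_eq_zero h0, Finset.sum_eq_zero h1]
  simp

theorem sum_form_eC {k : ℕ} (hk : k ∈ Finset.Icc 1 N) :
    ∑ j ∈ Finset.Icc 1 N, form M N (eC M N j) (eC M N k) = 1 := by
  rw [Finset.sum_eq_single_of_mem k hk]
  · rw [form_eC_eC hk, if_pos rfl]
  · intro j hj hjk
    rw [form_eC_eC hj, if_neg hjk]

theorem weight_eC {k : ℕ} (hk : k ∈ Finset.Icc 1 N) : weight M N (eC M N k) = 1 := by
  rw [weight, sum_form_eC hk, form_eC_eC hk, if_pos rfl]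
  norm_num

theorem weight_neg_eC {k : ℕ} (hk : k ∈ Finset.Icc 1 N) : weight M N (-eC M N k) = 0 := by
  simp only [weight, map_neg, LinearMap.neg_apply, Finset.sum_neg_distrib]
  rw [sum_form_eC hk, form_eC_eC hk, if_pos rfl]
  norm_num

theorem form_hVec_eC (i : ℕ) (m : ℤ) {j : ℕ} (hj : j ∈ Finset.Icc 1 N) :
    form M N (hVec M N τ i m) (eC M N j) = 0 := by
  rw [form_comm, form_eC_hVec hj]

/-- The charge of the current `X^{+,i}(z)`. -/
def rootVec (M N : ℕ) (i : ℕ) : Charge M N := circ M N 0 (Pi.single i 1)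

theorem hVec_eq_rootVec (τ : ℂ) {i : ℕ} (hi : i ≠ 0) (hiM : i < M) :
    hVec M N τ i 0 = rootVec M N i := by
  ext (k | l | l)
  · rw [hVec_inl hi]
    simp [rootVec, circ, qpow_zero, Pi.single_apply, eq_comm (a := i)]
  · have := l.2
    rw [hVec_inr_inl, if_neg (by omega), if_neg (by omega)]
    simp [rootVec, circ, show ¬ M + (l : ℕ) = i by omega,
      show ¬ M + (l : ℕ) + 1 = i by omega]
  · have := l.2
    rw [hVec_inr_inr]
    simp [rootVec, circ, show ¬ M + (l : ℕ) = i by omega,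
      show ¬ M + (l : ℕ) + 1 = i by omega]

theorem hVec_add_eC_eq_rootVec (τ : ℂ) (hM : 1 ≤ M) :
    hVec M N τ M 0 + eC M N 1 = rootVec M N M := by
  ext (k | l | l)
  · have := k.2
    rw [Pi.add_apply, hVec_inl (by omega)]
    simp [rootVec, circ, qpow_zero, Pi.single_apply, eC, eq_comm (a := M)]
  · rw [Pi.add_apply, hVec_inr_inl]
    simp [rootVec, circ, qpow_zero, Pi.single_apply, eC, show ¬ M + (l : ℕ) + 1 = M by omega]
    omega
  · rw [Pi.add_apply, hVec_inr_inr]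
    simp [rootVec, circ, Pi.single_apply, eC, show ¬ M + (l : ℕ) + 1 = M by omega]

theorem hVec_sub_eC_add_eC_eq_rootVec (τ : ℂ) {i : ℕ} (hi : M < i) :
    hVec M N τ i 0 + eC M N (i - M + 1) + -eC M N (i - M) = rootVec M N i := by
  obtain ⟨j, rfl⟩ : ∃ j, i = M + j + 1 := ⟨i - M - 1, by omega⟩
  rw [show M + j + 1 - M = j + 1 by omega]
  ext (k | l | l)
  · have := k.2
    simp only [Pi.add_apply, Pi.neg_apply]
    rw [hVec_inl (by omega)]
    simp [rootVec, circ, eC, show ¬ M + j + 1 = (k : ℕ) by omega,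
      show ¬ (k : ℕ) = M + j + 1 by omega, show ¬ M + j = (k : ℕ) by omega,
      show ¬ (k : ℕ) = M + j by omega]
  · simp only [Pi.add_apply, Pi.neg_apply]
    rw [hVec_inr_inl]
    simp [rootVec, circ, qpow_zero, Pi.single_apply, eC, add_assoc, eq_comm (a := j)]
    congr 1
    simp [eq_comm]
  · simp only [Pi.add_apply, Pi.neg_apply]
    rw [hVec_inr_inr]
    simp [rootVec, circ, Pi.single_apply, eC, add_assoc]
    ring

/-! ### The currents -/

/-- The oscillators of the field are combinations of those of the bosons `h^i` and `c^j`. -/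
def LinField.IsHomogeneous (τ : ℂ) (Φ : LinField M N) : Prop :=
  ∀ m : ℤ, m ≠ 0 → proj M N τ m.natAbs (Φ.osc m) = Φ.osc m

namespace LinField.IsHomogeneous

variable {A B : LinField M N}

theorem add (hA : A.IsHomogeneous τ) (hB : B.IsHomogeneous τ) : (A + B).IsHomogeneous τ :=
  fun m hm => by
    rw [show (A + B).osc m = A.osc m + B.osc m from rfl, map_add, hA m hm, hB m hm]

theorem neg (hA : A.IsHomogeneous τ) : (-A).IsHomogeneous τ := fun m hm => by
  rw [show (-A).osc m = -A.osc m from rfl, map_neg, hA m hm]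

theorem rescale (hA : A.IsHomogeneous τ) (t : ℂ) : (A.rescale τ t).IsHomogeneous τ :=
  fun m hm => by
    rw [show (A.rescale τ t).osc m = qpow τ (-t * m) • A.osc m from rfl, map_smul, hA m hm]

theorem constField (u : Charge M N) : (constField M N u).IsHomogeneous τ := fun _ _ =>
  map_zero _

theorem hField (hM : 1 ≤ M) (hN : 1 ≤ N) (hMN : M ≠ N) (hτ : ‖Complex.exp τ‖ < 1) {i : ℕ}
    (hi : i ∈ Finset.Icc 1 (M + N - 1)) (α : ℂ) : (hField M N τ i α).IsHomogeneous τ :=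
  fun m _ => by
    simp only [SuperBoson.hField, bosonField, map_smul, proj_hVec hM hN hMN hτ m hi]

theorem cField {j : ℕ} (hj : j ∈ Finset.Icc 1 N) (α : ℂ) : (cField M N τ j α).IsHomogeneous τ :=
  fun _ _ => by
    simp only [SuperBoson.cField, bosonField, map_smul, proj_eC _ hj]

end LinField.IsHomogeneous

theorem lie_smul_sub_of_lie {A : Type*} [Ring A] [Algebra ℂ A] {D a b : A} {r : ℂ} (s : ℂ)
    (ha : ⁅D, a⁆ = r • a) (hb : ⁅D, b⁆ = r • b) : ⁅D, s • (a - b)⁆ = r • s • (a - b) := by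
  rw [Ring.lie_def] at *
  rw [mul_smul_comm, smul_mul_assoc, ← smul_sub, mul_sub, sub_mul, sub_sub_sub_comm, ha, hb,
    ← smul_sub, smul_comm]

theorem lie_neg_of_lie {A : Type*} [Ring A] [Algebra ℂ A] {D a : A} {r : ℂ}
    (ha : ⁅D, a⁆ = r • a) : ⁅D, -a⁆ = r • -a := by
  rw [Ring.lie_def] at *
  rw [mul_neg, neg_mul, ← neg_sub', ha, smul_neg]

/-- The properties of the currents `X^{±,i}(z)`: the conformal weight is one, the charge is shifted
by `v`, and the exponents of `z` are congruent to the eigenvalues of the zero mode of `v`. -/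
structure IsCurrent (τ : ℂ) (v : Charge M N) (X : ℂ → Op M N) : Prop where
  lie (x : ℂ) : ⁅gradOp (proj M N τ) (vacEnergy M N τ), X x⁆ = (-(x + 1)) • X x
  preserves {S : Set (Charge M N)} (hS : ∀ μ ∈ S, μ + v ∈ S) (x : ℂ) :
    Preserves M N (X x) (Finsupp.supported (Poly M N) ℂ S)
  eq_zero {S : Set (Charge M N)} {x : ℂ} (hS : ∀ μ ∈ S, ∃ n : ℤ, form M N v μ = n)
    (hx : ¬ ∃ n : ℤ, x = n) {u : Fock M N} (hu : u ∈ Finsupp.supported (Poly M N) ℂ S) :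
    X x u = 0

theorem isCurrent_vertex {Φ : LinField M N} (hΦ : Φ.IsHomogeneous τ) {v : Charge M N}
    (hv : Φ.chg = v) (hp : proj M N τ 0 v = v) (hw : weight M N v = 1) :
    IsCurrent τ v (vertex M N τ Φ) := by
  subst hv
  refine ⟨fun x => ?_, preserves_vertex, vertex_eq_zero⟩
  rw [lie_gradOp_vertex form_proj hΦ (vacEnergy_add hp), hw]

theorem isCurrent_vertexDiff {A B : LinField M N} (hA : A.IsHomogeneous τ)
    (hB : B.IsHomogeneous τ) {v : Charge M N} (hv : A.chg + B.chg = v)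
    (hp : proj M N τ 0 v = v) (hw : weight M N v = 0) :
    IsCurrent τ v (vertexDiff M N τ A B) := by
  have hchg : ∀ t, (A + B.rescale τ t).chg = v := fun t => hv
  have hlie : ∀ t x, ⁅gradOp (proj M N τ) (vacEnergy M N τ),
      vertex M N τ (A + B.rescale τ t) (x + 1)⁆ =
        (-(x + 1)) • vertex M N τ (A + B.rescale τ t) (x + 1) := fun t x => by
    rw [lie_gradOp_vertex form_proj (hA.add (hB.rescale t)) (w := 0), add_zero]
    intro μ
    rw [hchg, vacEnergy_add hp, hw]
  refine ⟨fun x => ?_, fun {S} hS x u hu => ?_, fun {S x} hS hx u hu => ?_⟩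
  · exact lie_smul_sub_of_lie _ (hlie 1 x) (hlie (-1) x)
  · rw [vertexDiff, LinearMap.smul_apply, LinearMap.sub_apply]
    exact Submodule.smul_mem _ _ (Submodule.sub_mem _
      (preserves_vertex (by rwa [hchg]) _ u hu) (preserves_vertex (by rwa [hchg]) _ u hu))
  · have hx' : ¬ ∃ n : ℤ, x + 1 = n := fun ⟨n, hn⟩ =>
      hx ⟨n - 1, by push_cast; linear_combination hn⟩
    rw [vertexDiff, LinearMap.smul_apply, LinearMap.sub_apply,
      vertex_eq_zero (by rwa [hchg]) hx' hu, vertex_eq_zero (by rwa [hchg]) hx' hu, sub_zero,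
      smul_zero]

theorem IsCurrent.neg {v : Charge M N} {X : ℂ → Op M N} (H : IsCurrent τ v X) :
    IsCurrent τ v (fun x => -X x) := by
  refine ⟨fun x => ?_, fun {S} hS x u hu => ?_, fun {S x} hS hx u hu => ?_⟩
  · exact lie_neg_of_lie (H.lie x)
  · exact Submodule.neg_mem _ (H.preserves hS x u hu)
  · rw [LinearMap.neg_apply, H.eq_zero hS hx hu, neg_zero]

theorem proj_zero_hVec (hM : 1 ≤ M) (hN : 1 ≤ N) (hMN : M ≠ N) (hτ : ‖Complex.exp τ‖ < 1) {i : ℕ}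
    (hi : i ∈ Finset.Icc 1 (M + N - 1)) :
    proj M N τ 0 (hVec M N τ i 0) = hVec M N τ i 0 :=
  proj_hVec hM hN hMN hτ 0 hi

theorem isCurrent_XPlus (hM : 1 ≤ M) (hN : 1 ≤ N) (hMN : M ≠ N) (hτ : ‖Complex.exp τ‖ < 1) {i : ℕ}
    (hi : i ∈ Finset.Icc 1 (M + N - 1)) : IsCurrent τ (rootVec M N i) (XPlus M N τ i) := by
  have hp := proj_zero_hVec hM hN hMN hτ hi
  have hw := weight_hVec τ hM hN hi
  have hh := fun α => LinField.IsHomogeneous.hField hM hN hMN hτ hi α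
  have hi' := Finset.mem_Icc.mp hi
  rcases lt_trichotomy i M with hlt | rfl | hgt
  · rw [show XPlus M N τ i = _ from funext fun x => by rw [XPlus, if_pos hlt],
      ← hVec_eq_rootVec τ (by omega) hlt]
    rw [if_pos hlt] at hw
    exact isCurrent_vertex ((hh _).add (.constField _)) (add_zero _) hp hw
  · have h1 : 1 ∈ Finset.Icc 1 N := by simpa using hN
    rw [show XPlus i N τ i = _ from funext fun x => by
      rw [XPlus, if_neg (lt_irrefl _), if_pos rfl], ← hVec_add_eC_eq_rootVec τ hM]
    rw [if_neg (lt_irrefl _), if_pos rfl] at hw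
    refine isCurrent_vertex (((hh _).add (.cField h1 _)).add (.constField _)) (add_zero _) ?_ ?_
    · rw [map_add, hp, proj_eC _ h1]
    · rw [weight_add (form_hVec_eC _ _ h1), hw, weight_eC h1, zero_add]
  · have h1 : i - M ∈ Finset.Icc 1 N := by rw [Finset.mem_Icc]; omega
    have h2 : i - M + 1 ∈ Finset.Icc 1 N := by rw [Finset.mem_Icc]; omega
    rw [show XPlus M N τ i = _ from funext fun x => by
      rw [XPlus, if_neg (by omega), if_neg (by omega)], ← hVec_sub_eC_add_eC_eq_rootVec τ hgt]
    rw [if_neg (by omega), if_neg (by omega)] at hw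
    refine isCurrent_vertexDiff ((hh _).add (.cField h2 _)) (.neg (.cField h1 _)) rfl ?_ ?_
    · rw [map_add, map_add, map_neg, hp, proj_eC _ h1, proj_eC _ h2]
    · rw [weight_add, weight_add (form_hVec_eC _ _ h2), hw, weight_eC h2, weight_neg_eC h1]
      · ring
      · rw [map_neg, map_add, LinearMap.add_apply, form_hVec_eC _ _ h1, form_eC_eC h2,
          if_neg (by omega)]
        ring

theorem isCurrent_XMinus (hM : 1 ≤ M) (hN : 1 ≤ N) (hMN : M ≠ N) (hτ : ‖Complex.exp τ‖ < 1)
    {i : ℕ} (hi : i ∈ Finset.Icc 1 (M + N - 1)) :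
    IsCurrent τ (-rootVec M N i) (XMinus M N τ i) := by
  have hp := proj_zero_hVec hM hN hMN hτ hi
  have hw := weight_hVec τ hM hN hi
  rw [← weight_neg_hVec] at hw
  have hh := fun α => (LinField.IsHomogeneous.hField hM hN hMN hτ hi α).neg
  have hi' := Finset.mem_Icc.mp hi
  rcases lt_trichotomy i M with hlt | rfl | hgt
  · rw [show XMinus M N τ i = _ from funext fun x => by rw [XMinus, if_pos hlt],
      ← hVec_eq_rootVec τ (by omega) hlt]
    rw [if_pos hlt] at hw
    exact (isCurrent_vertex (v := -hVec M N τ i 0) ((hh _).add (.constField _)) (add_zero _)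
      (by rw [map_neg, hp]) hw).neg
  · have h1 : 1 ∈ Finset.Icc 1 N := by simpa using hN
    rw [show XMinus i N τ i = _ from funext fun x => by
      rw [XMinus, if_neg (lt_irrefl _), if_pos rfl], ← hVec_add_eC_eq_rootVec τ hM, neg_add]
    rw [if_neg (lt_irrefl _), if_pos rfl] at hw
    refine isCurrent_vertexDiff ((hh _).add (.constField _)) (.neg (.cField h1 _))
      (congrArg (· + -eC i N 1) (add_zero (-hVec i N τ i 0))) ?_ ?_
    · rw [map_add, map_neg, map_neg, hp, proj_eC _ h1]
    · rw [weight_add, hw, weight_neg_eC h1, zero_add]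
      simp [form_hVec_eC _ _ h1]
  · have h1 : i - M ∈ Finset.Icc 1 N := by rw [Finset.mem_Icc]; omega
    have h2 : i - M + 1 ∈ Finset.Icc 1 N := by rw [Finset.mem_Icc]; omega
    have hroot : -rootVec M N i = -hVec M N τ i 0 + eC M N (i - M) + -eC M N (i - M + 1) := by
      rw [← hVec_sub_eC_add_eC_eq_rootVec τ hgt]
      abel
    rw [show XMinus M N τ i = _ from funext fun x => by
      rw [XMinus, if_neg (by omega), if_neg (by omega)], hroot]
    rw [if_neg (by omega), if_neg (by omega)] at hw
    refine (isCurrent_vertexDiff (v := -hVec M N τ i 0 + eC M N (i - M) + -eC M N (i - M + 1))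
      ((hh _).add (.cField h1 _)) (.neg (.cField h2 _)) rfl ?_ ?_).neg
    · rw [map_add, map_add, map_neg, map_neg, hp, proj_eC _ h1, proj_eC _ h2]
    · rw [weight_add, weight_add, hw, weight_eC h1, weight_neg_eC h2]
      · ring
      · simp [form_hVec_eC _ _ h1]
      · simp only [map_neg, map_add, LinearMap.add_apply, LinearMap.neg_apply,
          form_hVec_eC _ _ h2, form_eC_eC h1]
        rw [if_neg (by omega)]
        ring

/-! ### The spaces `F_λ` -/

theorem circ_add (μ : Charge M N) (n n' : ℕ → ℤ) :
    circ M N μ n + circ M N 0 n' = circ M N μ (n + n') := by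
  ext (k | l | l) <;> simp [circ] <;> ring

theorem circ_zero_neg (n : ℕ → ℤ) : circ M N 0 (-n) = -circ M N 0 n := by
  ext (k | l | l) <;> simp [circ] <;> ring

/-- The charges of `F_μ`. -/
def fockCharges (μ : Charge M N) : Set (Charge M N) :=
  {ρ | ∃ n : ℕ → ℤ, n 0 = 0 ∧ n (M + N) = 0 ∧ ρ = circ M N μ n}

theorem add_rootVec_mem {μ ρ : Charge M N} (hρ : ρ ∈ fockCharges μ) {i : ℕ}
    (hi : i ∈ Finset.Icc 1 (M + N - 1)) : ρ + rootVec M N i ∈ fockCharges μ := by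
  obtain ⟨n, h0, h1, rfl⟩ := hρ
  rw [Finset.mem_Icc] at hi
  refine ⟨n + Pi.single i 1, ?_, ?_, circ_add _ _ _⟩
  · simp [h0, show ¬ 0 = i by omega]
  · simp [h1, show ¬ M + N = i by omega]

theorem add_neg_rootVec_mem {μ ρ : Charge M N} (hρ : ρ ∈ fockCharges μ) {i : ℕ}
    (hi : i ∈ Finset.Icc 1 (M + N - 1)) : ρ + -rootVec M N i ∈ fockCharges μ := by
  obtain ⟨n, h0, h1, rfl⟩ := hρ
  rw [Finset.mem_Icc] at hi
  refine ⟨n + -Pi.single i 1, ?_, ?_, ?_⟩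
  · simp [h0, show ¬ 0 = i by omega]
  · simp [h1, show ¬ M + N = i by omega]
  · rw [rootVec, ← circ_zero_neg, circ_add]

theorem preserves_sectorwise_zero (T : Charge M N → Module.End ℂ (Poly M N)) (μ : Charge M N) :
    Preserves M N (sectorwise M N 0 T) (fockModule M N μ) :=
  preserves_sectorwise (fun ρ hρ => by rwa [add_zero]) T

/-- The zero mode of each current is integral on the highest weight charges. Entries of the same
kind differ by integers, and at the odd node the parameter `α` of the mixed charges cancels
between `λ_b` and `λ_c`. -/
theorem exists_int_rootVec_highestCharge (hM : 1 ≤ M) (hN : 1 ≤ N) {μ : Charge M N}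
    (hμ : μ ∈ highestCharges M N) {i : ℕ} (hi : i ∈ Finset.Icc 1 (M + N - 1)) :
    ∃ n : ℤ, form M N (rootVec M N i) μ = n := by
  -- The zero mode coefficients `hVec M N τ i 0` do not depend on `τ`, so any value serves.
  rcases node_cases hi with ⟨k, hk, rfl⟩ | rfl | ⟨l, hl, rfl⟩
  · rw [← hVec_eq_rootVec 0 (by omega) hk, form_hVec_of_lt 0 hk]
    rcases hμ with ⟨i', β, -, -, rfl⟩ | ⟨α, β, rfl⟩
    · simp only [chargeFund]
      split_ifs
      exacts [⟨0, by simp⟩, ⟨1, by simp⟩, ⟨-1, by simp⟩, ⟨0, by simp⟩]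
    · exact ⟨0, by simp [chargeMixed]⟩
  · have e := form_eC (M := i) ⟨0, hN⟩ μ
    rw [zero_add] at e
    rw [← hVec_add_eC_eq_rootVec 0 hM, map_add, LinearMap.add_apply, form_hVec_self 0 hM hN, e]
    rcases hμ with ⟨i', β, -, -, rfl⟩ | ⟨α, β, rfl⟩
    · simp only [chargeFund]
      split_ifs <;> first
        | (exfalso; omega)
        | (refine ⟨0, ?_⟩; norm_num; done)
        | (refine ⟨1, ?_⟩; norm_num)
    · exact ⟨0, by simp [chargeMixed]⟩
  · have e1 := form_eC (M := M) ⟨l, by omega⟩ μ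
    have e2 := form_eC (M := M) ⟨l + 1, hl⟩ μ
    rw [← hVec_sub_eC_add_eC_eq_rootVec 0 (by omega), show M + l + 1 - M = l + 1 by omega,
      map_add, map_add, map_neg, LinearMap.add_apply, LinearMap.add_apply, LinearMap.neg_apply,
      form_hVec_of_gt 0 hl, e1, e2]
    rcases hμ with ⟨i', β, -, -, rfl⟩ | ⟨α, β, rfl⟩
    · simp only [chargeFund]
      split_ifs <;> first
        | (exfalso; omega)
        | (refine ⟨0, ?_⟩; norm_num)
    · exact ⟨0, by simp [chargeMixed]⟩

theorem exists_int_rootVec (hM : 1 ≤ M) (hN : 1 ≤ N) {μ : Charge M N}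
    (hμ : μ ∈ highestCharges M N) {i : ℕ} (hi : i ∈ Finset.Icc 1 (M + N - 1)) {ρ : Charge M N}
    (hρ : ρ ∈ fockCharges μ) : ∃ n : ℤ, form M N (rootVec M N i) ρ = n := by
  obtain ⟨n, -, -, rfl⟩ := hρ
  obtain ⟨a, ha⟩ := exists_int_rootVec_highestCharge hM hN hμ hi
  -- Both charges have integral entries, so their pairing is an integer.
  have hint : form M N (rootVec M N i) (circ M N 0 n) ∈ (Int.castRingHom ℂ).range := by
    have hc : ∀ (n : ℕ → ℤ) s, circ M N 0 n s ∈ (Int.castRingHom ℂ).range := by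
      rintro n (k | l | l) <;> exact ⟨_, by rw [circ, Pi.zero_apply, zero_add]; rfl⟩
    have hs : ∀ s, sgn M N s ∈ (Int.castRingHom ℂ).range := by
      rintro (k | l | l)
      exacts [⟨1, by simp [sgn]⟩, ⟨-1, by simp [sgn]⟩, ⟨1, by simp [sgn]⟩]
    simp only [← zeroVal_eq_form, zeroVal, rootVec]
    exact sum_mem fun s _ => mul_mem (hc (Pi.single i 1) s) (mul_mem (hs s) (hc n s))
  obtain ⟨b, hb⟩ := hint
  refine ⟨a + b, ?_⟩
  have hcirc : circ M N μ n = μ + circ M N 0 n := by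
    ext (k | l | l) <;> simp [circ]
  rw [hcirc, map_add, ha, ← hb]
  simp

end Currents

/-! ### The case `N = 1` -/

section One

variable {M : ℕ} {τ : ℂ}

theorem hStar_eq_hStarOne {i : ℕ} (hi : i ∈ Finset.Icc 1 M) (m : ℤ) :
    hStar M 1 τ i m = hStarOne M τ i m := by
  rw [Finset.mem_Icc] at hi
  have ha : ∀ j ∈ Finset.Icc 1 M, alpha M i j = (min i j : ℕ) := fun j hj => by
    rw [Finset.mem_Icc] at hj
    rw [alpha, if_pos (by omega), Nat.cast_min]
  have hb : ∀ j ∈ Finset.Icc 1 M, beta M 1 i j = (M : ℤ) - 1 - (max i j : ℕ) := fun j hj => by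
    rw [Finset.mem_Icc] at hj
    rw [beta, if_pos (by omega), Nat.cast_max, Nat.cast_one]
  rw [hStar, hStarOne, Nat.add_sub_cancel]
  split_ifs <;> refine Finset.sum_congr rfl fun j hj => ?_
  · rw [ha j hj, hb j hj]
    simp only [Int.cast_natCast, Int.cast_sub, Int.cast_one, Nat.cast_one]
  · rw [ha j hj, hb j hj]
    simp only [Nat.cast_min, Nat.cast_max, Nat.cast_one]

theorem gradingOp_eq_gradingOpOne : gradingOp M 1 τ = gradingOpOne M τ := by
  have hT : gradingTerm M 1 τ = fun m : {m : ℤ // m ≠ 0} =>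
      ((m.1 : ℂ) ^ 2 / qint τ m.1 ^ 2) •
        (∑ i ∈ Finset.Icc 1 M, normOrd M 1 (h M 1 τ i) (hStarOne M τ i) (-m.1) m.1 +
          normOrd M 1 (c M 1 τ 1) (c M 1 τ 1) (-m.1) m.1) := by
    funext m
    rw [gradingTerm, Nat.add_sub_cancel, Finset.Icc_self, Finset.sum_singleton]
    rw [Finset.sum_congr rfl fun i hi => by
      rw [show hStar M 1 τ i = hStarOne M τ i from funext (hStar_eq_hStarOne hi)]]
  rw [gradingOp, gradingOpOne, hT, Nat.add_sub_cancel, Finset.Icc_self, Finset.sum_singleton,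
    Finset.sum_congr rfl fun i hi => by rw [hStar_eq_hStarOne hi]]

end One

end SuperBoson

end

open SuperBoson in
theorem mainTheorem3 (M N : ℕ) (hM : 1 ≤ M) (hN : 1 ≤ N) (hMN : M ≠ N)
    (q τ : ℂ) (hq0 : 0 < ‖q‖) (hq1 : ‖q‖ < 1) (hτ : Complex.exp τ = q) :
    -- the infinite sums that define `d` and the vertex operators are locally finite
    SuperBoson.IsLocFinite (SuperBoson.gradingTerm M N τ) ∧
    (∀ (Φ : SuperBoson.LinField M N) (x : ℂ),
      SuperBoson.IsLocFinite (SuperBoson.vertexTerm M N τ Φ x)) ∧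
    -- `[d, H_m^i] = m H_m^i`, and in particular `[d, H_0^i] = 0`
    (∀ i ∈ Finset.Icc 1 (M + N - 1), ∀ m : ℤ,
      ⁅SuperBoson.gradingOp M N τ, SuperBoson.h M N τ i m⁆
        = (m : ℂ) • SuperBoson.h M N τ i m) ∧
    -- `[d, X_m^{±,i}] = m X_m^{±,i}`, where `X_m` is the coefficient of `z^{-m-1}`
    (∀ i ∈ Finset.Icc 1 (M + N - 1), ∀ m : ℤ,
      ⁅SuperBoson.gradingOp M N τ, SuperBoson.XPlus M N τ i (-m - 1)⁆
          = (m : ℂ) • SuperBoson.XPlus M N τ i (-m - 1) ∧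
      ⁅SuperBoson.gradingOp M N τ, SuperBoson.XMinus M N τ i (-m - 1)⁆
          = (m : ℂ) • SuperBoson.XMinus M N τ i (-m - 1)) ∧
    -- the operator `q^d` exists and is invertible, with inverse `q^{-d}`
    (∃ qd : SuperBoson.Fock M N ≃ₗ[ℂ] SuperBoson.Fock M N,
      SuperBoson.IsExpOf (τ • SuperBoson.gradingOp M N τ) qd.toLinearMap ∧
      SuperBoson.IsExpOf (-τ • SuperBoson.gradingOp M N τ) qd.symm.toLinearMap ∧
      -- `q^d X^{±,i}(z) q^{-d} = q⁻¹ X^{±,i}(q⁻¹ z)`, coefficient of `z^x`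
      (∀ i ∈ Finset.Icc 1 (M + N - 1), ∀ x : ℂ,
        qd.toLinearMap * SuperBoson.XPlus M N τ i x * qd.symm.toLinearMap
          = (q⁻¹ * SuperBoson.qpow τ (-x)) • SuperBoson.XPlus M N τ i x ∧
        qd.toLinearMap * SuperBoson.XMinus M N τ i x * qd.symm.toLinearMap
          = (q⁻¹ * SuperBoson.qpow τ (-x)) • SuperBoson.XMinus M N τ i x) ∧
      -- `q^d e^{±Q_c^j} q^{-d} = e^{±Q_c^j} q^{∓c_0^j} q^{-(1±1)/2}`
      (∀ j ∈ Finset.Icc 1 N,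
        qd.toLinearMap * SuperBoson.expQ M N (SuperBoson.eC M N j) * qd.symm.toLinearMap
          = q⁻¹ • (SuperBoson.expQ M N (SuperBoson.eC M N j) *
              SuperBoson.expZero M N (-τ • SuperBoson.eC M N j)) ∧
        qd.toLinearMap * SuperBoson.expQ M N (-SuperBoson.eC M N j) * qd.symm.toLinearMap
          = SuperBoson.expQ M N (-SuperBoson.eC M N j) *
              SuperBoson.expZero M N (τ • SuperBoson.eC M N j)) ∧
      -- `q^d e^{±Q_h^i} q^{-d} = e^{±Q_h^i} q^{∓h_0^i}` times `q⁻¹`, `1` or `q`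
      (∀ i ∈ Finset.Icc 1 (M + N - 1),
        qd.toLinearMap * SuperBoson.expQ M N (SuperBoson.hVec M N τ i 0)
            * qd.symm.toLinearMap
          = (if i < M then q⁻¹ else if i = M then 1 else q) •
            (SuperBoson.expQ M N (SuperBoson.hVec M N τ i 0) *
              SuperBoson.expZero M N (-τ • SuperBoson.hVec M N τ i 0)) ∧
        qd.toLinearMap * SuperBoson.expQ M N (-SuperBoson.hVec M N τ i 0)
            * qd.symm.toLinearMap
          = (if i < M then q⁻¹ else if i = M then 1 else q) •
            (SuperBoson.expQ M N (-SuperBoson.hVec M N τ i 0) *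
              SuperBoson.expZero M N (τ • SuperBoson.hVec M N τ i 0))) ∧
      -- `q^d` and `q^{-d}` act on each `F_λ`
      (∀ μ ∈ SuperBoson.highestCharges M N,
        SuperBoson.Preserves M N qd.toLinearMap (SuperBoson.fockModule M N μ) ∧
        SuperBoson.Preserves M N qd.symm.toLinearMap (SuperBoson.fockModule M N μ))) ∧
    -- `d`, `H_m^i` and `X_m^{±,i}` act on each `F_λ`, where only the powers `z^{-m-1}`
    -- with integral `m` occur in `X^{±,i}(z)`
    (∀ μ ∈ SuperBoson.highestCharges M N,
      SuperBoson.Preserves M N (SuperBoson.gradingOp M N τ) (SuperBoson.fockModule M N μ) ∧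
      ∀ i ∈ Finset.Icc 1 (M + N - 1),
        (∀ m : ℤ,
          SuperBoson.Preserves M N (SuperBoson.h M N τ i m)
            (SuperBoson.fockModule M N μ) ∧
          SuperBoson.Preserves M N (SuperBoson.XPlus M N τ i (-m - 1))
            (SuperBoson.fockModule M N μ) ∧
          SuperBoson.Preserves M N (SuperBoson.XMinus M N τ i (-m - 1))
            (SuperBoson.fockModule M N μ)) ∧
        ∀ x : ℂ, (¬ ∃ n : ℤ, x = n) → ∀ v ∈ SuperBoson.fockModule M N μ,
          SuperBoson.XPlus M N τ i x v = 0 ∧ SuperBoson.XMinus M N τ i x v = 0) ∧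
    -- the formula for `N = 1`
    (2 ≤ M → SuperBoson.gradingOp M 1 τ = SuperBoson.gradingOpOne M τ) := by

  subst hτ
  have hP := fun k v => proj_proj (k := k + 1) hM hN hMN hq1 v
  have hG := gradingOp_eq (M := M) (N := N) hq1
  have hXp := fun i (hi : i ∈ Finset.Icc 1 (M + N - 1)) => isCurrent_XPlus hM hN hMN hq1 hi
  have hXm := fun i (hi : i ∈ Finset.Icc 1 (M + N - 1)) => isCurrent_XMinus hM hN hMN hq1 hi
  have hexp : ∀ x : ℂ, Complex.exp (τ * -(x + 1)) = (Complex.exp τ)⁻¹ * qpow τ (-x) := fun x => by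
    rw [qpow, ← Complex.exp_neg, ← Complex.exp_add]
    congr 1
    ring
  have hcoeff : ∀ m : ℤ, -((-(m : ℂ) - 1) + 1) = m := fun m => by ring
  refine ⟨isLocFinite_gradingTerm hq1, fun Φ x => isLocFinite_vertexTerm Φ x, fun i hi m => ?_,
    fun i hi m => ⟨?_, ?_⟩,
    ⟨flowEquiv hP (vacEnergy M N τ) τ, ?_, ?_, fun i hi x => ⟨?_, ?_⟩, fun j hj => ⟨?_, ?_⟩,
      fun i hi => ⟨?_, ?_⟩, fun μ _ => ⟨preserves_sectorwise_zero _ μ,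
        preserves_sectorwise_zero _ μ⟩⟩,
    fun μ hμ => ⟨?_, fun i hi => ⟨fun m => ⟨?_, ?_, ?_⟩, fun x hx v hv => ⟨?_, ?_⟩⟩⟩,
    fun _ => gradingOp_eq_gradingOpOne⟩
  · rw [hG]
    exact lie_gradOp_mode _ form_proj fun _ => proj_hVec hM hN hMN hq1 m hi
  · rw [hG, (hXp i hi).lie, hcoeff]
  · rw [hG, (hXm i hi).lie, hcoeff]
  · rw [hG]
    exact isExpOf_flow hP _ τ
  · rw [hG]
    exact isExpOf_flow hP _ (-τ)
  · rw [← hexp]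
    exact flow_conj_of_lie hP _ τ ((hXp i hi).lie x)
  · rw [← hexp]
    exact flow_conj_of_lie hP _ τ ((hXm i hi).lie x)
  · refine (flow_conj_expQ hP (vacEnergy_add (proj_eC 0 hj)) τ).trans ?_
    rw [weight_eC hj, mul_one, Complex.exp_neg]
  · refine (flow_conj_expQ hP
      (vacEnergy_add (v := -eC M N j) (by rw [map_neg, proj_eC 0 hj])) τ).trans ?_
    rw [weight_neg_eC hj, mul_zero, neg_zero, Complex.exp_zero, one_smul, neg_smul_neg]
  · refine (flow_conj_expQ hP (vacEnergy_add (proj_zero_hVec hM hN hMN hq1 hi)) τ).trans ?_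
    rw [weight_hVec τ hM hN hi]
    congr 1
    split_ifs <;> simp [Complex.exp_neg]
  · refine (flow_conj_expQ hP (vacEnergy_add (v := -hVec M N τ i 0)
      (by rw [map_neg, proj_zero_hVec hM hN hMN hq1 hi])) τ).trans ?_
    rw [weight_neg_hVec, weight_hVec τ hM hN hi, neg_smul_neg]
    congr 1
    split_ifs <;> simp [Complex.exp_neg]
  · rw [hG]
    exact preserves_sectorwise_zero _ μ
  · exact preserves_of_lie_eq_zero fun ε => lie_chargeOp_mode ε _ m
  · exact (hXp i hi).preserves (fun ρ hρ => add_rootVec_mem hρ hi) _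
  · exact (hXm i hi).preserves (fun ρ hρ => add_neg_rootVec_mem hρ hi) _
  · exact (hXp i hi).eq_zero (fun ρ hρ => exists_int_rootVec hM hN hμ hi hρ) hx hv
  · refine (hXm i hi).eq_zero (fun ρ hρ => ?_) hx hv
    obtain ⟨n, hn⟩ := exists_int_rootVec hM hN hμ hi hρ
    exact ⟨-n, by rw [map_neg, LinearMap.neg_apply, hn, Int.cast_neg]⟩
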